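/- Let $M$ and $P$ be smooth finite-dimensional Hausdorff manifolds without boundary. Let $\pi:E\to M$ be a Lie algebroid: a smooth real vector bundle of finite rank with a Lie bracket $[\![\cdot,\cdot]\!]$ on the space $\Gamma(E)$ of global smooth sections and a smooth vector bundle morphism $\rho:E\to TM$ over $\mathrm{id}_M$ (the anchor) such that $\rho[\![v,w]\!]=[\rho v,\rho w]$ and $[\![v,fw]\!]=\rho(v)(f)\,w+f[\![v,w]\!]$ for all $v,w\in\Gamma(E)$ and $f\in C^\infty(M)$. Let $\tau:P\to M$ be a fibration, that is, a surjective submersion. For $p\in P$ put $$\mathcal T^E_pP=\{(b,v)\in E_{\tau(p)}\times T_pP \mid \rho(b)=T_p\tau(v)\},\qquad \mathcal T^EP=\bigcup_{p\in P}\mathcal T^E_pP\subset E\times TP .$$ Then $\mathcal T^EP$, with the topology of a subspace of $E\times TP$, is a smooth vector bundle over $P$ of rank $\operatorname{rank}E+\dim P-\dim M$, with projection $(p,b,v)\mapsto p$, whose smooth structure is that of a subbundle of $\tau^*E\oplus TP$ (a local section $p\mapsto(p,b(p),v(p))$ is smooth if and only if $b$ and $v$ are smooth). It carries a Lie algebroid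 structure whose anchor is the projection $\mathcal T^EP\to TP$, $(p,b,v)\mapsto v$, and whose bracket satisfies the following: if, near $p\in P$, global smooth sections $\Sigma_i$ of $\mathcal T^EP$ ($i=1,2$) have the form $\Sigma_i(q)=(q,\sigma_i(\tau(q)),X_i(q))$ with $\sigma_i\in\Gamma(E)$, then $$[\![\Sigma_1,\Sigma_2]\!](p)=\bigl(p,\,[\![\sigma_1,\sigma_2]\!](\tau(p)),\,[X_1,X_2](p)\bigr).$$ -/

import Mathlib

open Bundle Filter
open scoped Manifold ContDiff Topology Bundle

noncomputable section

section LieAlgebroid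

variable {EM : Type*} [NormedAddCommGroup EM] [NormedSpace ℝ EM]
  {HM : Type*} [TopologicalSpace HM] (I : ModelWithCorners ℝ EM HM)
  {M : Type*} [TopologicalSpace M] [ChartedSpace HM M]
  (F : Type*) [NormedAddCommGroup F] [NormedSpace ℝ F]
  (V : M → Type*) [TopologicalSpace (TotalSpace F V)]
  [∀ x, TopologicalSpace (V x)] [∀ x, AddCommGroup (V x)] [∀ x, Module ℝ (V x)]
  [FiberBundle F V] [VectorBundle ℝ F V]

variable {I F V} in
/-- The smooth section `f • s`, for `f ∈ C^∞(M)` and `s ∈ Γ(V)`. -/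
def smulSection (f : C^∞⟮I, M; 𝓘(ℝ, ℝ), ℝ⟯) (s : Cₛ^∞⟮I; F, V⟯) : Cₛ^∞⟮I; F, V⟯ :=
  ⟨fun x => f x • s x, f.contMDiff.smul_section s.contMDiff⟩

/-- A Lie algebroid structure on the smooth real vector bundle `V → M` with model fibre `F`:
a Lie bracket on the space of global smooth sections and a smooth vector bundle morphism
`ρ : V → TM` over the identity (the anchor), such that `ρ[v, w] = [ρ v, ρ w]` and
`[v, f w] = ρ(v)(f) w + f [v, w]`. -/
structure LieAlgebroid [IsManifold I ∞ M] where
  /-- the bracket of global smooth sections -/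
  bracket : Cₛ^∞⟮I; F, V⟯ →ₗ[ℝ] Cₛ^∞⟮I; F, V⟯ →ₗ[ℝ] Cₛ^∞⟮I; F, V⟯
  /-- the anchor, fibre by fibre -/
  anchor : ∀ x, V x →ₗ[ℝ] TangentSpace I x
  contMDiff_anchor : ContMDiff (I.prod 𝓘(ℝ, F)) I.tangent ∞
    (fun z : TotalSpace F V => (⟨z.proj, anchor z.proj z.snd⟩ : TangentBundle I M))
  bracket_self : ∀ v, bracket v v = 0
  jacobi : ∀ u v w,
    bracket u (bracket v w) + bracket v (bracket w u) + bracket w (bracket u v) = 0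
  anchor_bracket : ∀ v w x, anchor x (bracket v w x) =
    VectorField.mlieBracket I (fun y => anchor y (v y)) (fun y => anchor y (w y)) x
  leibniz : ∀ (f : C^∞⟮I, M; 𝓘(ℝ, ℝ), ℝ⟯) (v w : Cₛ^∞⟮I; F, V⟯) (x : M),
    bracket v (smulSection f w) x = mvfderiv I f x (anchor x (v x)) • w x + f x • bracket v w x

end LieAlgebroid

/-- A fibration `τ : P → M` of smooth manifolds: a surjective submersion. -/
structure IsFibration {EM : Type*} [NormedAddCommGroup EM] [NormedSpace ℝ EM]
    {HM : Type*} [TopologicalSpace HM] (I : ModelWithCorners ℝ EM HM)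
    {M : Type*} [TopologicalSpace M] [ChartedSpace HM M]
    {EP : Type*} [NormedAddCommGroup EP] [NormedSpace ℝ EP]
    {HP : Type*} [TopologicalSpace HP] (J : ModelWithCorners ℝ EP HP)
    {P : Type*} [TopologicalSpace P] [ChartedSpace HP P] (τ : P → M) : Prop where
  contMDiff : ContMDiff J I ∞ τ
  surjective : Function.Surjective τ
  surjective_mfderiv : ∀ p, Function.Surjective (mfderiv J I τ p)

namespace LieAlgebroid

variable {EM : Type*} [NormedAddCommGroup EM] [NormedSpace ℝ EM]
  {HM : Type*} [TopologicalSpace HM] {I : ModelWithCorners ℝ EM HM}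
  {M : Type*} [TopologicalSpace M] [ChartedSpace HM M] [IsManifold I ∞ M]
  {F : Type*} [NormedAddCommGroup F] [NormedSpace ℝ F]
  {V : M → Type*} [TopologicalSpace (TotalSpace F V)]
  [∀ x, TopologicalSpace (V x)] [∀ x, AddCommGroup (V x)] [∀ x, Module ℝ (V x)]
  [FiberBundle F V] [VectorBundle ℝ F V]
  {EP : Type*} [NormedAddCommGroup EP] [NormedSpace ℝ EP]
  {HP : Type*} [TopologicalSpace HP]
  {P : Type*} [TopologicalSpace P] [ChartedSpace HP P]

/-- The fibre at `p` of the prolongation of the Lie algebroid `A` along `τ : P → M`: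
the vector space of all `(b, v) ∈ V_{τ p} × T_p P` with `ρ(b) = T_p τ (v)`. -/
def prolongFiber (A : LieAlgebroid I F V) (J : ModelWithCorners ℝ EP HP) (τ : P → M) (p : P) :
    Submodule ℝ (V (τ p) × TangentSpace J p) where
  carrier := {z | A.anchor (τ p) z.1 = mfderiv J I τ p z.2}
  zero_mem' := by simp
  add_mem' {a b} ha hb := by
    simp only [Set.mem_ofPred_eq, Prod.fst_add, Prod.snd_add, map_add] at *
    rw [ha, hb]
  smul_mem' c a ha := by
    simp only [Set.mem_ofPred_eq, Prod.smul_fst, Prod.smul_snd, map_smul] at *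
    rw [ha]

/-- The family of vector spaces over `P` which makes up the prolongation. -/
abbrev Prolongation (A : LieAlgebroid I F V) (J : ModelWithCorners ℝ EP HP) (τ : P → M) :
    P → Type _ :=
  fun p => A.prolongFiber J τ p

/-- The model fibre of the prolongation: `ℝ^k` with `k = rank V + (dim P - dim M)`. -/
abbrev ProlongationModel (EM F EP : Type*) [NormedAddCommGroup EM] [NormedSpace ℝ EM]
    [NormedAddCommGroup F] [NormedSpace ℝ F] [NormedAddCommGroup EP] [NormedSpace ℝ EP] : Type :=
  EuclideanSpace ℝ
    (Fin (Module.finrank ℝ F + (Module.finrank ℝ EP - Module.finrank ℝ EM)))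

/-- The inclusion `(p, b, v) ↦ (b, v)` of the total space of the prolongation in `V × TP`. -/
def prolongInclusion (A : LieAlgebroid I F V) (J : ModelWithCorners ℝ EP HP) (τ : P → M)
    (F' : Type*) (z : TotalSpace F' (A.Prolongation J τ)) :
    TotalSpace F V × TangentBundle J P :=
  (⟨τ z.proj, z.snd.1.1⟩, ⟨z.proj, z.snd.1.2⟩)

/-- The total space of the prolongation is topologized as a subspace of `V × TP`. -/
instance prolongTopology (A : LieAlgebroid I F V) (J : ModelWithCorners ℝ EP HP)
    [IsManifold J ∞ P] (τ : P → M) (F' : Type*) :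
    TopologicalSpace (TotalSpace F' (A.Prolongation J τ)) :=
  .induced (A.prolongInclusion J τ F') inferInstance

end LieAlgebroid

end

/-! The bundle. In local trivializations of `V`, `TP` and `TM` the equation `ρ(b) = T_q τ(v)`
becomes a smooth family of linear maps `C_q : F × EP → EM`, and the fibre of the prolongation is
`ker C_q`. Since `τ` is a submersion, `C_{p₀}` is onto, so it can be completed by linear coordinates
`k` to an isomorphism `(C_{p₀}, k)`. Invertibility is an open condition, so `(C_q, k)` is still an
isomorphism for `q` near `p₀`, and `k` restricted to `ker C_q` is a trivialization. The explicit
smooth inverse shows that smoothness of a section is smoothness of its two components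
(`contMDiffAt_prolong_iff`).

The bracket. Its second component is forced to be the Lie bracket of vector fields. For the first, a
bracket of sections of `V` reads in a trivialization as `ρ(s)(t) - ρ(t)(s) + C(s, t)`, with
structure functions `C` (`structMap`, `fiberCoord_bracket`). Replacing the derivatives along `ρ(s)`
by derivatives along the vector fields `X_i`, and `C` by its pullback along `τ`, gives `X₁(s₂) -
X₂(s₁) + C(s₁, s₂)`, which makes sense for all sections of the prolongation.

Everything rests on one principle: for `(b, v)` in the prolongation, a function pulled back from `M`
has along `v` the derivative of the original function along `ρ(b)` (`mvfderiv_comp_proj`). Each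
property of the new bracket then follows from an identity of `C` on `M`: independence of the
trivialization from `structMap_change`, compatibility with the equation of the prolongation from
`anchorDeriv_structMap`, and the Jacobi identity from `structMap_jacobi`. On projectable sections
the principle turns the new formula back into that of `A`. -/

set_option linter.unusedSectionVars false

noncomputable section

/-! ### Calculus of vector-valued functions on manifolds -/

section VectorValuedDerivative

variable {EM : Type*} [NormedAddCommGroup EM] [NormedSpace ℝ EM]
  {HM : Type*} [TopologicalSpace HM] {I : ModelWithCorners ℝ EM HM}
  {M : Type*} [TopologicalSpace M] [ChartedSpace HM M]
  {EP : Type*} [NormedAddCommGroup EP] [NormedSpace ℝ EP]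
  {HP : Type*} [TopologicalSpace HP] {J : ModelWithCorners ℝ EP HP}
  {P : Type*} [TopologicalSpace P] [ChartedSpace HP P]
  {G G₁ G₂ : Type*} [NormedAddCommGroup G] [NormedSpace ℝ G]
  [NormedAddCommGroup G₁] [NormedSpace ℝ G₁] [NormedAddCommGroup G₂] [NormedSpace ℝ G₂]

theorem Filter.EventuallyEq.mvfderiv_eq {f g : P → G} {p : P} (h : f =ᶠ[𝓝 p] g) :
    mvfderiv J f p = mvfderiv J g p := by
  ext v
  exact congrArg (fun L : EP →L[ℝ] G => L v) (h.mfderiv_eq (I := J) (I' := 𝓘(ℝ, G)))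

theorem mvfderiv_comp_apply_of_mdifferentiableAt {g : M → G} {f : P → M} {p : P}
    (hg : MDifferentiableAt I 𝓘(ℝ, G) g (f p)) (hf : MDifferentiableAt J I f p)
    (v : TangentSpace J p) :
    mvfderiv J (fun q => g (f q)) p v = mvfderiv I g (f p) (mfderiv J I f p v) :=
  mfderiv_comp_apply p hg hf v

theorem mvfderiv_bilinear (B : G₁ →L[ℝ] G₂ →L[ℝ] G) {f : P → G₁} {g : P → G₂} {p : P}
    (hf : MDifferentiableAt J 𝓘(ℝ, G₁) f p) (hg : MDifferentiableAt J 𝓘(ℝ, G₂) g p)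
    (v : TangentSpace J p) :
    mvfderiv J (fun q => B (f q) (g q)) p v =
      B (mvfderiv J f p v) (g p) + B (f p) (mvfderiv J g p v) := by
  have h : HasMFDerivAt J 𝓘(ℝ, G₁ × G₂) (fun q => (f q, g q)) p
      ((mfderiv J 𝓘(ℝ, G₁) f p).prod (mfderiv J 𝓘(ℝ, G₂) g p)) :=
    ⟨hf.hasMFDerivAt.1.prodMk hg.hasMFDerivAt.1, hf.hasMFDerivAt.2.prodMk hg.hasMFDerivAt.2⟩
  have h2 := ((B.isBoundedBilinearMap.hasFDerivAt (f p, g p)).hasMFDerivAt).comp p h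
  have h3 := h2.mfderiv
  have h4 := congrArg (fun L : EP →L[ℝ] G => L v) h3
  refine h4.trans ?_
  exact add_comm _ _

theorem mvfderiv_clm_apply {f : P → G₁ →L[ℝ] G} {g : P → G₁} {p : P}
    (hf : MDifferentiableAt J 𝓘(ℝ, G₁ →L[ℝ] G) f p) (hg : MDifferentiableAt J 𝓘(ℝ, G₁) g p)
    (v : TangentSpace J p) :
    mvfderiv J (fun q => f q (g q)) p v =
      mvfderiv J f p v (g p) + f p (mvfderiv J g p v) :=
  mvfderiv_bilinear (ContinuousLinearMap.id ℝ (G₁ →L[ℝ] G)) hf hg v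

theorem mvfderiv_clm_const_apply (L : G₁ →L[ℝ] G) {g : P → G₁} {p : P}
    (hg : MDifferentiableAt J 𝓘(ℝ, G₁) g p) (v : TangentSpace J p) :
    mvfderiv J (fun q => L (g q)) p v = L (mvfderiv J g p v) := by
  rw [mvfderiv_clm_apply mdifferentiableAt_const hg, mvfderiv_const]
  simp

/-- In finite dimension an operator is the finite sum of its values on a basis times the coordinate
functionals. This reduces smoothness of transition maps, structure functions and constraint maps to
fixed arguments. -/
theorem contMDiffAt_clm_of_apply [FiniteDimensional ℝ G₁] {n : ℕ∞ω} {f : P → G₁ →L[ℝ] G} {p : P}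
    (h : ∀ v, ContMDiffAt J 𝓘(ℝ, G) n (fun q => f q v) p) :
    ContMDiffAt J 𝓘(ℝ, G₁ →L[ℝ] G) n f p := by
  let b := Module.finBasis ℝ G₁
  have hf : f = fun q => ∑ i, ContinuousLinearMap.smulRightL ℝ G₁ G
      (LinearMap.toContinuousLinearMap (b.coord i)) (f q (b i)) := by
    funext q
    ext v
    conv_lhs => rw [← b.sum_repr v, map_sum]
    simp
  rw [hf]
  refine ContMDiffAt.sum fun i _ => ?_
  exact (ContinuousLinearMap.contMDiff _).contMDiffAt.comp p (h (b i))

end VectorValuedDerivative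

/-! ### Coordinates in the preferred trivializations -/

section LocalCoordinates

variable {EM : Type*} [NormedAddCommGroup EM] [NormedSpace ℝ EM]
  {HM : Type*} [TopologicalSpace HM] {I : ModelWithCorners ℝ EM HM}
  {M : Type*} [TopologicalSpace M] [ChartedSpace HM M]
  (F : Type*) [NormedAddCommGroup F] [NormedSpace ℝ F]
  (V : M → Type*) [TopologicalSpace (TotalSpace F V)]
  [∀ x, TopologicalSpace (V x)] [∀ x, AddCommGroup (V x)] [∀ x, Module ℝ (V x)]
  [FiberBundle F V] [VectorBundle ℝ F V]
  {EP : Type*} [NormedAddCommGroup EP] [NormedSpace ℝ EP]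
  {HP : Type*} [TopologicalSpace HP] {J : ModelWithCorners ℝ EP HP}
  {P : Type*} [TopologicalSpace P] [ChartedSpace HP P]

/-- The domain of the preferred trivialization at `x₀`. -/
abbrev coordDomain (x₀ : M) : Set M := (trivializationAt F V x₀).baseSet

/-- The coordinates of a vector in the preferred trivialization at `x₀`. -/
abbrev fiberCoord (x₀ x : M) : V x →L[ℝ] F :=
  (trivializationAt F V x₀).continuousLinearMapAt ℝ x

/-- The vector at `x` with given coordinates in the preferred trivialization at `x₀`. -/
abbrev fiberVec (x₀ x : M) : F →L[ℝ] V x := (trivializationAt F V x₀).symmL ℝ x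

theorem isOpen_coordDomain (x₀ : M) : IsOpen (coordDomain F V x₀) :=
  (trivializationAt F V x₀).open_baseSet

theorem mem_coordDomain_self (x₀ : M) : x₀ ∈ coordDomain F V x₀ :=
  FiberBundle.mem_baseSet_trivializationAt' x₀

variable {F V}

theorem fiberCoord_fiberVec {x₀ x : M} (h : x ∈ coordDomain F V x₀) (v : F) :
    fiberCoord F V x₀ x (fiberVec F V x₀ x v) = v :=
  (trivializationAt F V x₀).continuousLinearMapAt_symmL h v

theorem fiberVec_fiberCoord {x₀ x : M} (h : x ∈ coordDomain F V x₀) (v : V x) :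
    fiberVec F V x₀ x (fiberCoord F V x₀ x v) = v :=
  (trivializationAt F V x₀).symmL_continuousLinearMapAt h v

theorem fiberCoord_injective {x₀ x : M} (h : x ∈ coordDomain F V x₀) :
    Function.Injective (fiberCoord F V x₀ x) :=
  Function.LeftInverse.injective (fiberVec_fiberCoord h)

variable [ContMDiffVectorBundle ∞ F V I]

/-- The trivialization may be centred at any `x₀` whose domain contains `t p`, and the section lies
over a map `t`; sections of `τ^* V` are thus covered without forming the pullback bundle. -/
theorem contMDiffAt_iff_fiberCoord {t : P → M} {s : ∀ q, V (t q)} {p : P} {x₀ : M}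
    (h : t p ∈ coordDomain F V x₀) :
    ContMDiffAt J (I.prod 𝓘(ℝ, F)) ∞ (fun q => TotalSpace.mk' F (t q) (s q)) p ↔
      ContMDiffAt J I ∞ t p ∧
        ContMDiffAt J 𝓘(ℝ, F) ∞ (fun q => fiberCoord F V x₀ (t q) (s q)) p := by
  rw [(trivializationAt F V x₀).contMDiffAt_iff (by rwa [Trivialization.mem_source])]
  refine and_congr_right fun ht => Filter.EventuallyEq.contMDiffAt_iff ?_
  filter_upwards [ht.continuousAt.preimage_mem_nhds ((isOpen_coordDomain F V x₀).mem_nhds h)]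
    with q hq
  exact ((trivializationAt F V x₀).continuousLinearMapAt_apply_of_mem (R := ℝ) hq _).symm

theorem contMDiffAt_fiberVec {x₀ x : M} (h : x ∈ coordDomain F V x₀) (v : F) :
    ContMDiffAt I (I.prod 𝓘(ℝ, F)) ∞ (fun y => TotalSpace.mk' F y (fiberVec F V x₀ y v)) x := by
  rw [contMDiffAt_iff_fiberCoord (t := fun y => y) h]
  refine ⟨contMDiffAt_id, (contMDiffAt_const (c := v)).congr_of_eventuallyEq ?_⟩
  filter_upwards [(isOpen_coordDomain F V x₀).mem_nhds h] with y hy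
  exact fiberCoord_fiberVec hy v

/-- The coordinates of a local frame in another trivialization depend smoothly on the point. -/
theorem contMDiffAt_fiberCoord_comp_fiberVec [FiniteDimensional ℝ F] {x₀ x₁ x : M}
    (h₀ : x ∈ coordDomain F V x₀) (h₁ : x ∈ coordDomain F V x₁) :
    ContMDiffAt I 𝓘(ℝ, F →L[ℝ] F) ∞
      (fun y => (fiberCoord F V x₁ y).comp (fiberVec F V x₀ y)) x :=
  contMDiffAt_clm_of_apply fun v =>
    ((contMDiffAt_iff_fiberCoord (t := fun y => y) h₁).1 (contMDiffAt_fiberVec h₀ v)).2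

end LocalCoordinates

/-! ### Derivatives along vector fields and the commutator identity -/

section DirectionalDerivative

variable {EP : Type*} [NormedAddCommGroup EP] [NormedSpace ℝ EP]
  {HP : Type*} [TopologicalSpace HP] {J : ModelWithCorners ℝ EP HP}
  {P : Type*} [TopologicalSpace P] [ChartedSpace HP P] [IsManifold J ∞ P]
  {G : Type*} [NormedAddCommGroup G] [NormedSpace ℝ G]

/-- The derivative of a smooth function along a smooth vector field is smooth. -/
theorem ContMDiffAt.mvfderiv_apply {f : P → G} {X : ∀ q : P, TangentSpace J q} {p : P}
    (hf : ContMDiffAt J 𝓘(ℝ, G) ∞ f p)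
    (hX : ContMDiffAt J J.tangent ∞ (fun q => (⟨q, X q⟩ : TangentBundle J P)) p) :
    ContMDiffAt J 𝓘(ℝ, G) ∞ (fun q => mvfderiv J f q (X q)) p := by
  -- The derivative of `f` is smooth in tangent coordinates. There it is `mfderiv` precomposed with
  -- `fiberVec`, so applying it to the coordinates of `X` gives back the derivative along `X`.
  have h := hf.mfderiv_const (m := ∞) (by simp)
  have hX' := ((contMDiffAt_iff_fiberCoord (t := fun q => q) (s := X) (F := EP)
    (mem_coordDomain_self EP (TangentSpace J) p)).1 hX).2
  refine (h.clm_apply hX').congr_of_eventuallyEq ?_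
  filter_upwards [(isOpen_coordDomain EP (TangentSpace J : P → Type _) p).mem_nhds
    (mem_coordDomain_self EP (TangentSpace J) p)] with q hq
  have h0 := inTangentCoordinates_eq (I := J) (I' := 𝓘(ℝ, G)) id f
    (fun x => (mfderiv J 𝓘(ℝ, G) f x : EP →L[ℝ] G)) (x₀ := p) (x := q) hq (Set.mem_univ _)
  have h1 := fiberVec_fiberCoord hq (X q)
  rw [fiberVec, TangentBundle.symmL_trivializationAt_eq_core hq] at h1
  rw [tangentBundleCore_coordChange_model_space] at h0
  have h2 := congrArg (fun L : EP →L[ℝ] G => L (fiberCoord EP (TangentSpace J) p q (X q))) h0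
  refine Eq.symm (h2.trans ?_)
  exact congrArg (fun v : EP => (mfderiv J 𝓘(ℝ, G) f q : EP →L[ℝ] G) v) h1

variable [J.Boundaryless]

open VectorField in
variable (J) in
/-- A vector field read in the chart at `p₀`. -/
def chartField (p₀ : P) (X : ∀ q : P, TangentSpace J q) : EP → EP :=
  mpullbackWithin 𝓘(ℝ, EP) J (extChartAt J p₀).symm X (Set.range J)

open VectorField in
theorem differentiableAt_chartField [CompleteSpace EP] {X : ∀ q : P, TangentSpace J q} {p : P}
    (hX : ContMDiffAt J J.tangent ∞ (fun q => (⟨q, X q⟩ : TangentBundle J P)) p) :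
    DifferentiableAt ℝ (chartField J p X) (extChartAt J p p) := by
  have : IsManifold J 1 P := .of_le (n := ∞) (by simp)
  have : IsManifold J 2 P := .of_le (n := ∞) ENat.LEInfty.out
  have h : DifferentiableWithinAt ℝ (chartField J p X)
      ((extChartAt J p).symm ⁻¹' Set.univ ∩ Set.range J) (extChartAt J p p) :=
    (hX.mdifferentiableAt (by simp)).mdifferentiableWithinAt
      (s := Set.univ) |>.differentiableWithinAt_mpullbackWithin_vectorField
  rwa [Set.preimage_univ, Set.univ_inter, J.range_eq_univ, differentiableWithinAt_univ] at h

open VectorField in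
theorem mvfderiv_comp_extChartAt_symm {g : P → G} (Y : ∀ q : P, TangentSpace J q) {p₀ p : P}
    {y : EP} (hy : y ∈ (extChartAt J p₀).target) (hp : (extChartAt J p₀).symm y = p)
    (hg : MDifferentiableAt J 𝓘(ℝ, G) g p) :
    mvfderiv J g p (Y p) = fderiv ℝ (g ∘ (extChartAt J p₀).symm) y
      (chartField J p₀ Y y) := by
  subst hp
  have hφ : MDifferentiableAt 𝓘(ℝ, EP) J (extChartAt J p₀).symm y :=
    ((contMDiffOn_extChartAt_symm (I := J) (n := 1) p₀).contMDiffAt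
      ((isOpen_extChartAt_target p₀).mem_nhds hy)).mdifferentiableAt one_ne_zero
  have hinv := isInvertible_mfderivWithin_extChartAt_symm (I := J) hy
  rw [J.range_eq_univ, mfderivWithin_univ] at hinv
  rw [← mfderiv_eq_fderiv, mfderiv_comp y hg hφ, chartField, mpullbackWithin_apply, J.range_eq_univ,
    mfderivWithin_univ]
  obtain ⟨L, hL⟩ := hinv
  rw [← hL, ContinuousLinearMap.inverse_equiv]
  have hv : (mfderiv 𝓘(ℝ, EP) J (extChartAt J p₀).symm y)
      (L.symm (Y ((extChartAt J p₀).symm y))) = Y ((extChartAt J p₀).symm y) := by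
    rw [← hL]
    exact L.apply_symm_apply _
  refine (congrArg (mfderiv J 𝓘(ℝ, G) g ((extChartAt J p₀).symm y)) hv).symm.trans ?_
  rw [← hL]
  rfl

open VectorField in
-- The identity `[X, Y] f = X (Y f) - Y (X f)`. Read in a chart, it is the symmetry of the second
-- derivative of `f`.
theorem mvfderiv_mlieBracket {f : P → G} {X Y : ∀ q : P, TangentSpace J q} {p : P}
    [CompleteSpace EP]
    (hf : ContMDiffAt J 𝓘(ℝ, G) ∞ f p)
    (hX : ContMDiffAt J J.tangent ∞ (fun q => (⟨q, X q⟩ : TangentBundle J P)) p)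
    (hY : ContMDiffAt J J.tangent ∞ (fun q => (⟨q, Y q⟩ : TangentBundle J P)) p) :
    mvfderiv J f p (mlieBracket J X Y p) =
      mvfderiv J (fun q => mvfderiv J f q (Y q)) p (X p) -
        mvfderiv J (fun q => mvfderiv J f q (X q)) p (Y p) := by
  have : IsManifold J 1 P := .of_le (n := ∞) (by simp)
  have : IsManifold J 2 P := .of_le (n := ∞) ENat.LEInfty.out
  have : IsManifold J (minSmoothness ℝ 2) P := by simpa using ‹IsManifold J 2 P›
  set φ := extChartAt J p with hφ
  have hy : φ p ∈ φ.target := mem_extChartAt_target p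
  have hp : φ.symm (φ p) = p := extChartAt_to_inv p
  have hXd := differentiableAt_chartField hX
  have hYd := differentiableAt_chartField hY
  have hf' : ContDiffAt ℝ ∞ (f ∘ φ.symm) (φ p) := by
    have := (contMDiffAt_iff.1 hf).2
    rwa [J.range_eq_univ, contDiffWithinAt_univ] at this
  have hev : ∀ᶠ y in 𝓝 (φ p), y ∈ φ.target ∧ MDifferentiableAt J 𝓘(ℝ, G) f (φ.symm y) := by
    refine Filter.Eventually.and ((isOpen_extChartAt_target p).mem_nhds hy) ?_
    have h1 : ∀ᶠ q in 𝓝 p, MDifferentiableAt J 𝓘(ℝ, G) f q :=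
      ((contMDiffAt_iff_contMDiffAt_nhds (n := 1) (by simp)).1 (hf.of_le (by simp))).mono
        fun q hq => hq.mdifferentiableAt one_ne_zero
    have h2 : ContinuousAt φ.symm (φ p) := continuousAt_extChartAt_symm p
    refine h2.eventually ?_
    rwa [hp]
  have key : ∀ (Z : ∀ q : P, TangentSpace J q),
      (fun q => mvfderiv J f q (Z q)) ∘ φ.symm =ᶠ[𝓝 (φ p)] fun y => fderiv ℝ (f ∘ φ.symm) y
        (chartField J p Z y) := fun Z => by
    filter_upwards [hev] with y hy
    exact mvfderiv_comp_extChartAt_symm Z hy.1 rfl hy.2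
  rw [mvfderiv_comp_extChartAt_symm X hy hp
      ((hf.mvfderiv_apply hY).mdifferentiableAt (by simp)),
    mvfderiv_comp_extChartAt_symm Y hy hp
      ((hf.mvfderiv_apply hX).mdifferentiableAt (by simp)),
    (key Y).fderiv_eq, (key X).fderiv_eq]
  have hcomp : f =ᶠ[𝓝 p] (f ∘ φ.symm) ∘ φ := by
    filter_upwards [extChartAt_source_mem_nhds (I := J) p] with q hq
    exact congrArg f (φ.left_inv hq).symm
  have hφd : MDifferentiableAt J 𝓘(ℝ, EP) φ p := mdifferentiableAt_extChartAt (by simp)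
  -- The bracket at `p` is the pullback by the chart of the bracket of the chart fields; pushing it
  -- forward cancels the inverse derivative.
  have hbr : (mfderiv J 𝓘(ℝ, EP) φ p) (mlieBracket J X Y p) =
      fderiv ℝ (chartField J p Y) (φ p) (chartField J p X (φ p)) - fderiv ℝ (chartField J p X) (φ p) (chartField J p Y (φ p)) := by
    have h1 : mlieBracket J X Y p = (mfderiv J 𝓘(ℝ, EP) φ p).inverse
        (lieBracketWithin ℝ (chartField J p X) (chartField J p Y)
          (φ.symm ⁻¹' Set.univ ∩ Set.range J) (φ p) : EP) := by
      rw [mlieBracket, mlieBracketWithin_apply]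
      rfl
    obtain ⟨L, hL⟩ := isInvertible_mfderiv_extChartAt (I := J) (mem_extChartAt_source (I := J) p)
    rw [h1, ← hL, ContinuousLinearMap.inverse_equiv, Set.preimage_univ, Set.univ_inter,
      J.range_eq_univ, lieBracketWithin_univ]
    exact L.apply_symm_apply _
  have hL : mvfderiv J f p (mlieBracket J X Y p) = fderiv ℝ (f ∘ φ.symm) (φ p)
      (mfderiv J 𝓘(ℝ, EP) φ p (mlieBracket J X Y p)) := by
    rw [hcomp.mvfderiv_eq]
    have h1 := mvfderiv_comp_apply_of_mdifferentiableAt (I := 𝓘(ℝ, EP)) (J := J)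
      (hf'.differentiableAt (by simp)).mdifferentiableAt hφd (mlieBracket J X Y p)
    refine h1.trans ?_
    exact congrArg (fun L : EP →L[ℝ] G => L (mfderiv J 𝓘(ℝ, EP) φ p (mlieBracket J X Y p)))
      mfderiv_eq_fderiv
  rw [hL, hbr]
  exact fderiv_apply_lieBracket hf'
    (by rw [minSmoothness_of_isRCLikeNormedField]; exact ENat.LEInfty.out) hYd hXd

end DirectionalDerivative

/-! ### Bump functions and global sections extending local frames -/

section SmoothSections

variable {EM : Type*} [NormedAddCommGroup EM] [NormedSpace ℝ EM] [FiniteDimensional ℝ EM]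
  {HM : Type*} [TopologicalSpace HM] (I : ModelWithCorners ℝ EM HM)
  {M : Type*} [TopologicalSpace M] [T2Space M] [ChartedSpace HM M] [IsManifold I ∞ M]
  (F : Type*) [NormedAddCommGroup F] [NormedSpace ℝ F]
  (V : M → Type*) [TopologicalSpace (TotalSpace F V)]
  [∀ x, TopologicalSpace (V x)] [∀ x, AddCommGroup (V x)] [∀ x, Module ℝ (V x)]
  [FiberBundle F V] [VectorBundle ℝ F V] [ContMDiffVectorBundle ∞ F V I]

variable {F V} in
theorem contMDiff_smul_section_of_tsupport (χ : C^∞⟮I, M; 𝓘(ℝ, ℝ), ℝ⟯) {s : ∀ x, V x}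
    (h : ∀ x ∈ tsupport χ,
      ContMDiffAt I (I.prod 𝓘(ℝ, F)) ∞ (fun y => TotalSpace.mk' F y (s y)) x) :
    ContMDiff I (I.prod 𝓘(ℝ, F)) ∞ (fun y => TotalSpace.mk' F y (χ y • s y)) := by
  intro x
  by_cases hx : x ∈ tsupport χ
  · exact χ.contMDiff.contMDiffAt.smul_section (h x hx)
  · refine (contMDiff_zeroSection ℝ V).contMDiffAt.congr_of_eventuallyEq (I' := I.prod 𝓘(ℝ, F)) ?_
    filter_upwards [(isClosed_tsupport χ).isOpen_compl.mem_nhds hx] with y hy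
    rw [image_eq_zero_of_notMem_tsupport hy, zero_smul]
    rfl

/-- The bracket accepts only global sections, so local frames must be cut off. The cutoff is `1` on
a whole neighbourhood, which leaves derivatives at nearby points unchanged. -/
theorem exists_contMDiffMap_eventuallyEq_one {x₀ : M} {U : Set M} (hU : U ∈ 𝓝 x₀) :
    ∃ χ : C^∞⟮I, M; 𝓘(ℝ, ℝ), ℝ⟯, tsupport χ ⊆ U ∧ ∀ᶠ x in 𝓝 x₀, χ x = 1 := by
  obtain ⟨f, -, hf⟩ := (SmoothBumpFunction.nhds_basis_tsupport (I := I) x₀).mem_iff.1 hU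
  exact ⟨⟨f, f.contMDiff⟩, hf, f.eventuallyEq_one⟩

/-- A smooth bump function at `x₀`, supported in the domain of the preferred trivialization. -/
def bumpAt (x₀ : M) : C^∞⟮I, M; 𝓘(ℝ, ℝ), ℝ⟯ :=
  (exists_contMDiffMap_eventuallyEq_one I
    ((isOpen_coordDomain F V x₀).mem_nhds (mem_coordDomain_self F V x₀))).choose

theorem tsupport_bumpAt_subset (x₀ : M) : tsupport (bumpAt I F V x₀) ⊆ coordDomain F V x₀ :=
  (exists_contMDiffMap_eventuallyEq_one I
    ((isOpen_coordDomain F V x₀).mem_nhds (mem_coordDomain_self F V x₀))).choose_spec.1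

/-- The open neighbourhood of `x₀` on which the bump function at `x₀` is locally equal to `1`. -/
def flatDomain (x₀ : M) : Set M := interior {x | bumpAt I F V x₀ x = 1}

theorem isOpen_flatDomain (x₀ : M) : IsOpen (flatDomain I F V x₀) := isOpen_interior

theorem mem_flatDomain_self (x₀ : M) : x₀ ∈ flatDomain I F V x₀ :=
  mem_interior_iff_mem_nhds.2 (exists_contMDiffMap_eventuallyEq_one I
    ((isOpen_coordDomain F V x₀).mem_nhds (mem_coordDomain_self F V x₀))).choose_spec.2

variable {I F V}

theorem bumpAt_eq_one {x₀ x : M} (hx : x ∈ flatDomain I F V x₀) : bumpAt I F V x₀ x = 1 :=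
  interior_subset (s := {x | bumpAt I F V x₀ x = 1}) hx

theorem flatDomain_subset_coordDomain (x₀ : M) : flatDomain I F V x₀ ⊆ coordDomain F V x₀ :=
  fun x hx => tsupport_bumpAt_subset I F V x₀ <| subset_tsupport _ <| by
    rw [Function.mem_support, bumpAt_eq_one hx]
    exact one_ne_zero

variable (I F V) in
/-- Global smooth sections which have constant coordinates near `x₀`. -/
def constSection (x₀ : M) : F →ₗ[ℝ] Cₛ^∞⟮I; F, V⟯ where
  toFun v := ⟨fun x => bumpAt I F V x₀ x • fiberVec F V x₀ x v,
    contMDiff_smul_section_of_tsupport I _ fun _ hx =>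
      contMDiffAt_fiberVec (tsupport_bumpAt_subset I F V x₀ hx) v⟩
  map_add' v w := by
    ext x
    simp [smul_add, map_add]
  map_smul' c v := by
    ext x
    simp [smul_comm c, map_smul]

theorem constSection_apply {x₀ x : M} (hx : x ∈ flatDomain I F V x₀) (v : F) :
    constSection I F V x₀ v x = fiberVec F V x₀ x v := by
  change bumpAt I F V x₀ x • fiberVec F V x₀ x v = _
  rw [bumpAt_eq_one hx, one_smul]

theorem fiberCoord_constSection {x₀ x : M} (hx : x ∈ flatDomain I F V x₀) (v : F) :
    fiberCoord F V x₀ x (constSection I F V x₀ v x) = v := by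
  rw [constSection_apply hx, fiberCoord_fiberVec (flatDomain_subset_coordDomain x₀ hx)]

theorem contMDiffAt_fiberCoord_section (s : Cₛ^∞⟮I; F, V⟯) {x₀ x : M}
    (hx : x ∈ coordDomain F V x₀) :
    ContMDiffAt I 𝓘(ℝ, F) ∞ (fun y => fiberCoord F V x₀ y (s y)) x :=
  ((contMDiffAt_iff_fiberCoord (t := fun y => y) hx).1 s.contMDiff.contMDiffAt).2

variable (I F V) in
/-- Evaluation of smooth sections at a point. -/
def evalSection (x : M) : Cₛ^∞⟮I; F, V⟯ →ₗ[ℝ] V x where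
  toFun s := s x
  map_add' _ _ := rfl
  map_smul' _ _ := rfl

/-- Near any point of the flat domain, a section is a combination of constant sections. -/
theorem exists_eventuallyEq_sum_constSection {ι : Type*} [Fintype ι] (b : Module.Basis ι ℝ F)
    [FiniteDimensional ℝ F] (s : Cₛ^∞⟮I; F, V⟯) (x₀ : M) :
    ∃ c : ι → C^∞⟮I, M; 𝓘(ℝ, ℝ), ℝ⟯, ∀ x ∈ flatDomain I F V x₀,
      (∀ i, c i x = b.repr (fiberCoord F V x₀ x (s x)) i) ∧
        s x = (∑ i, smulSection (c i) (constSection I F V x₀ (b i))) x := by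
  -- The coefficients are the coordinates of `s`, cut off to be globally smooth. Together with
  -- `constSection` the sum carries the bump function twice, which is harmless on the flat domain.
  have hc : ∀ i, ContMDiff I 𝓘(ℝ, ℝ) ∞ fun x =>
      bumpAt I F V x₀ x • b.repr (fiberCoord F V x₀ x (s x)) i := fun i x => by
    by_cases hx : x ∈ tsupport (bumpAt I F V x₀)
    · refine (bumpAt I F V x₀).contMDiff.contMDiffAt.smul ?_
      exact (LinearMap.toContinuousLinearMap (b.coord i)).contMDiff.contMDiffAt.comp x
        (contMDiffAt_fiberCoord_section s (tsupport_bumpAt_subset I F V x₀ hx))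
    · refine (contMDiffAt_const (c := (0 : ℝ))).congr_of_eventuallyEq ?_
      filter_upwards [(isClosed_tsupport (bumpAt I F V x₀)).isOpen_compl.mem_nhds hx] with y hy
      rw [image_eq_zero_of_notMem_tsupport hy, zero_smul]
  have hval : ∀ x ∈ flatDomain I F V x₀, ∀ i,
      bumpAt I F V x₀ x • b.repr (fiberCoord F V x₀ x (s x)) i =
        b.repr (fiberCoord F V x₀ x (s x)) i := fun x hx i => by
    rw [bumpAt_eq_one hx, one_smul]
  refine ⟨fun i => ⟨_, hc i⟩, fun x hx => ⟨hval x hx, ?_⟩⟩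
  have hsum : (∑ i, smulSection (⟨_, hc i⟩ : C^∞⟮I, M; 𝓘(ℝ, ℝ), ℝ⟯)
      (constSection I F V x₀ (b i))) x =
      ∑ i, b.repr (fiberCoord F V x₀ x (s x)) i • fiberVec F V x₀ x (b i) := by
    refine (map_sum (evalSection I F V x) _ _).trans ?_
    refine Finset.sum_congr rfl fun i _ => ?_
    change (bumpAt I F V x₀ x • b.repr (fiberCoord F V x₀ x (s x)) i) •
      constSection I F V x₀ (b i) x = _
    rw [hval x hx, constSection_apply hx]
  rw [hsum]
  have := congrArg (fiberVec F V x₀ x) (b.sum_repr (fiberCoord F V x₀ x (s x)))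
  rw [map_sum, fiberVec_fiberCoord (flatDomain_subset_coordDomain x₀ hx)] at this
  simpa only [map_smul] using this.symm

end SmoothSections

/-! ### Local formulas for a Lie algebroid -/

namespace LieAlgebroid

section LocalFormulas

variable {EM : Type*} [NormedAddCommGroup EM] [NormedSpace ℝ EM]
  {HM : Type*} [TopologicalSpace HM] {I : ModelWithCorners ℝ EM HM}
  {M : Type*} [TopologicalSpace M] [ChartedSpace HM M] [IsManifold I ∞ M]
  {F : Type*} [NormedAddCommGroup F] [NormedSpace ℝ F]
  {V : M → Type*} [TopologicalSpace (TotalSpace F V)]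
  [∀ x, TopologicalSpace (V x)] [∀ x, AddCommGroup (V x)] [∀ x, Module ℝ (V x)]
  [FiberBundle F V] [VectorBundle ℝ F V]
  (A : LieAlgebroid I F V)

theorem bracket_swap (s t : Cₛ^∞⟮I; F, V⟯) : A.bracket s t = -A.bracket t s := by
  have h := A.bracket_self (s + t)
  simp only [map_add, LinearMap.add_apply, A.bracket_self, zero_add, add_zero] at h
  exact eq_neg_of_add_eq_zero_right h

theorem bracket_swap_apply (s t : Cₛ^∞⟮I; F, V⟯) (x : M) :
    A.bracket s t x = -A.bracket t s x :=
  congrArg (fun u : Cₛ^∞⟮I; F, V⟯ => u x) (A.bracket_swap s t)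

theorem contMDiffAt_anchor {EP : Type*} [NormedAddCommGroup EP] [NormedSpace ℝ EP]
    {HP : Type*} [TopologicalSpace HP] {J : ModelWithCorners ℝ EP HP}
    {P : Type*} [TopologicalSpace P] [ChartedSpace HP P] {t : P → M} {s : ∀ q, V (t q)} {p : P}
    (hs : ContMDiffAt J (I.prod 𝓘(ℝ, F)) ∞ (fun q => TotalSpace.mk' F (t q) (s q)) p) :
    ContMDiffAt J I.tangent ∞
      (fun q => (⟨t q, A.anchor (t q) (s q)⟩ : TangentBundle I M)) p :=
  A.contMDiff_anchor.contMDiffAt.comp p hs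

variable [FiniteDimensional ℝ EM] [T2Space M] [ContMDiffVectorBundle ∞ F V I]

/-- Take `χ = 1` near `x`, supported where `t` vanishes. Then `χ t = 0`, and the Leibniz rule at `x`
leaves only `[s, t](x)`. -/
theorem bracket_apply_eq_zero {s t : Cₛ^∞⟮I; F, V⟯} {x : M} (ht : ∀ᶠ y in 𝓝 x, t y = 0) :
    A.bracket s t x = 0 := by
  obtain ⟨χ, hχ, hχ1⟩ := exists_contMDiffMap_eventuallyEq_one I ht
  have h0 : smulSection χ t = 0 := by
    ext y
    change χ y • t y = 0
    by_cases hy : y ∈ tsupport χ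
    · rw [show t y = 0 from hχ hy, smul_zero]
    · rw [image_eq_zero_of_notMem_tsupport hy, zero_smul]
  have h := A.leibniz χ s t x
  rw [h0, map_zero, ht.self_of_nhds, smul_zero, zero_add, hχ1.self_of_nhds, one_smul] at h
  exact h.symm

theorem bracket_congr_right {s t t' : Cₛ^∞⟮I; F, V⟯} {x : M} (ht : ∀ᶠ y in 𝓝 x, t y = t' y) :
    A.bracket s t x = A.bracket s t' x := by
  have h := A.bracket_apply_eq_zero (s := s) (t := t - t') (x := x)
    (ht.mono fun y hy => sub_eq_zero.2 hy)
  rw [map_sub] at h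
  exact sub_eq_zero.1 h

variable [FiniteDimensional ℝ F]

/-- Expand `t` in the local frame and apply the Leibniz rule: the derivatives of the coefficients
assemble into the derivative of the coordinates of `t`, and what remains is the bracket with the
frozen value `t x`. -/
theorem fiberCoord_bracket_eq_add (s t : Cₛ^∞⟮I; F, V⟯) {x₀ x : M}
    (hx : x ∈ flatDomain I F V x₀) :
    fiberCoord F V x₀ x (A.bracket s t x) =
      mvfderiv I (fun y => fiberCoord F V x₀ y (t y)) x (A.anchor x (s x)) +
        fiberCoord F V x₀ x
          (A.bracket s (constSection I F V x₀ (fiberCoord F V x₀ x (t x))) x) := by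
  let b := Module.finBasis ℝ F
  obtain ⟨c, hc⟩ := exists_eventuallyEq_sum_constSection b t x₀
  have hU := (isOpen_flatDomain I F V x₀).mem_nhds hx
  have hd : MDifferentiableAt I 𝓘(ℝ, F) (fun y => fiberCoord F V x₀ y (t y)) x :=
    (contMDiffAt_fiberCoord_section t (flatDomain_subset_coordDomain x₀ hx)).mdifferentiableAt
      (by simp)
  have hder : ∀ i, mvfderiv I (c i) x (A.anchor x (s x)) =
      b.repr (mvfderiv I (fun y => fiberCoord F V x₀ y (t y)) x (A.anchor x (s x))) i := fun i => by
    have h1 : (c i : M → ℝ) =ᶠ[𝓝 x] fun y =>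
        LinearMap.toContinuousLinearMap (b.coord i) (fiberCoord F V x₀ y (t y)) := by
      filter_upwards [hU] with y hy
      exact (hc y hy).1 i
    rw [h1.mvfderiv_eq, mvfderiv_clm_const_apply _ hd]
    rfl
  have key : A.bracket s t x = ∑ i, (mvfderiv I (c i) x (A.anchor x (s x)) •
      fiberVec F V x₀ x (b i) + c i x • A.bracket s (constSection I F V x₀ (b i)) x) := by
    rw [A.bracket_congr_right (Filter.mem_of_superset hU fun y hy => (hc y hy).2), map_sum]
    refine (map_sum (evalSection I F V x) _ _).trans (Finset.sum_congr rfl fun i _ => ?_)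
    refine (A.leibniz (c i) s _ x).trans ?_
    rw [constSection_apply hx]
  have h2 : A.bracket s (constSection I F V x₀ (fiberCoord F V x₀ x (t x))) x =
      ∑ i, c i x • A.bracket s (constSection I F V x₀ (b i)) x := by
    conv_lhs => rw [← b.sum_repr (fiberCoord F V x₀ x (t x)), map_sum, map_sum]
    refine (map_sum (evalSection I F V x) _ _).trans (Finset.sum_congr rfl fun i _ => ?_)
    rw [map_smul, map_smul, map_smul, (hc x hx).1 i]
    rfl
  rw [key, h2, Finset.sum_add_distrib, map_add]
  congr 1
  rw [map_sum]
  conv_rhs => rw [← b.sum_repr (mvfderiv I _ x (A.anchor x (s x)))]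
  refine Finset.sum_congr rfl fun i _ => ?_
  rw [map_smul, fiberCoord_fiberVec (flatDomain_subset_coordDomain x₀ hx), hder]

/-- The structure functions of a Lie algebroid at `x` in the preferred trivialization at `x₀`. -/
def structMap (x₀ x : M) : F →L[ℝ] F →L[ℝ] F :=
  LinearMap.toContinuousBilinearMap
    ((A.bracket.compl₁₂ (constSection I F V x₀) (constSection I F V x₀)).compr₂
      ((fiberCoord F V x₀ x : V x →ₗ[ℝ] F) ∘ₗ evalSection I F V x))

theorem structMap_apply (x₀ x : M) (v w : F) :
    A.structMap x₀ x v w = fiberCoord F V x₀ x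
      (A.bracket (constSection I F V x₀ v) (constSection I F V x₀ w) x) := rfl

theorem structMap_swap (x₀ x : M) (v w : F) :
    A.structMap x₀ x v w = -A.structMap x₀ x w v := by
  rw [structMap_apply, A.bracket_swap_apply, map_neg, structMap_apply]

theorem contMDiffAt_structMap_apply {x₀ x : M} (hx : x ∈ coordDomain F V x₀) (v w : F) :
    ContMDiffAt I 𝓘(ℝ, F) ∞ (fun y => A.structMap x₀ y v w) x :=
  contMDiffAt_fiberCoord_section _ hx

theorem contMDiffAt_structMap {x₀ x : M} (hx : x ∈ coordDomain F V x₀) :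
    ContMDiffAt I 𝓘(ℝ, F →L[ℝ] F →L[ℝ] F) ∞ (A.structMap x₀) x :=
  contMDiffAt_clm_of_apply fun v => contMDiffAt_clm_of_apply fun w =>
    A.contMDiffAt_structMap_apply hx v w

theorem mvfderiv_structMap_apply {x₀ x : M} (hx : x ∈ coordDomain F V x₀) (v w : F)
    (ξ : TangentSpace I x) :
    mvfderiv I (A.structMap x₀) x ξ v w = mvfderiv I (fun y => A.structMap x₀ y v w) x ξ := by
  have h := (A.contMDiffAt_structMap hx).mdifferentiableAt (by simp)
  have h1 := (contMDiffAt_clm_of_apply fun w =>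
    A.contMDiffAt_structMap_apply hx v w).mdifferentiableAt (by simp)
  rw [mvfderiv_clm_apply h1 mdifferentiableAt_const, mvfderiv_clm_apply h mdifferentiableAt_const,
    mvfderiv_const, mvfderiv_const]
  simp

/-- The bracket of sections in a local trivialization. -/
theorem fiberCoord_bracket (s t : Cₛ^∞⟮I; F, V⟯) {x₀ x : M} (hx : x ∈ flatDomain I F V x₀) :
    fiberCoord F V x₀ x (A.bracket s t x) =
      mvfderiv I (fun y => fiberCoord F V x₀ y (t y)) x (A.anchor x (s x)) -
        mvfderiv I (fun y => fiberCoord F V x₀ y (s y)) x (A.anchor x (t x)) +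
        A.structMap x₀ x (fiberCoord F V x₀ x (s x)) (fiberCoord F V x₀ x (t x)) := by
  have h1 : mvfderiv I (fun y => fiberCoord F V x₀ y
      (constSection I F V x₀ (fiberCoord F V x₀ x (t x)) y)) x = 0 := by
    rw [Filter.EventuallyEq.mvfderiv_eq (g := fun _ => fiberCoord F V x₀ x (t x)), mvfderiv_const]
    filter_upwards [(isOpen_flatDomain I F V x₀).mem_nhds hx] with y hy
    exact fiberCoord_constSection hy _
  -- The one-sided formula is used in `t`, then, after antisymmetry, in `s`; the bracket of the two
  -- frozen sections is `structMap`.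
  rw [A.fiberCoord_bracket_eq_add s t hx, A.bracket_swap_apply s, map_neg,
    A.fiberCoord_bracket_eq_add _ s hx, A.structMap_apply,
    A.bracket_swap_apply (constSection I F V x₀ (fiberCoord F V x₀ x (s x))), map_neg,
    constSection_apply hx, fiberVec_fiberCoord (flatDomain_subset_coordDomain x₀ hx)]
  abel

/-- The Jacobi identity for sections with constant coordinates. Their brackets have the non-constant
coordinates `structMap`, so the outer bracket differentiates the structure functions along the
anchor. -/
theorem structMap_jacobi {x₀ x : M} (hx : x ∈ flatDomain I F V x₀) (u v w : F) :
    (mvfderiv I (A.structMap x₀) x (A.anchor x (fiberVec F V x₀ x u)) v w +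
        A.structMap x₀ x u (A.structMap x₀ x v w)) +
      (mvfderiv I (A.structMap x₀) x (A.anchor x (fiberVec F V x₀ x v)) w u +
        A.structMap x₀ x v (A.structMap x₀ x w u)) +
      (mvfderiv I (A.structMap x₀) x (A.anchor x (fiberVec F V x₀ x w)) u v +
        A.structMap x₀ x w (A.structMap x₀ x u v)) = 0 := by
  have hx' := flatDomain_subset_coordDomain x₀ hx
  have key : ∀ u v w : F, mvfderiv I (A.structMap x₀) x (A.anchor x (fiberVec F V x₀ x u)) v w +
      A.structMap x₀ x u (A.structMap x₀ x v w) = fiberCoord F V x₀ x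
        (A.bracket (constSection I F V x₀ u)
          (A.bracket (constSection I F V x₀ v) (constSection I F V x₀ w)) x) := fun u v w => by
    have h1 : mvfderiv I (fun y => fiberCoord F V x₀ y (constSection I F V x₀ u y)) x = 0 := by
      rw [Filter.EventuallyEq.mvfderiv_eq (g := fun _ => u), mvfderiv_const]
      filter_upwards [(isOpen_flatDomain I F V x₀).mem_nhds hx] with y hy
      exact fiberCoord_constSection hy _
    rw [A.fiberCoord_bracket _ _ hx, h1, A.mvfderiv_structMap_apply hx',
      fiberCoord_constSection hx, constSection_apply hx]
    simp [structMap_apply]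
  rw [key, key, key, ← map_add, ← map_add]
  refine (congrArg (fiberCoord F V x₀ x) (congrArg (evalSection I F V x)
    (A.jacobi (constSection I F V x₀ u) (constSection I F V x₀ v)
      (constSection I F V x₀ w)))).trans ?_
  rw [map_zero, map_zero]

variable {G : Type*} [NormedAddCommGroup G] [NormedSpace ℝ G]

/-- The derivative of `h` along the anchor, in the preferred trivialization at `x₀`. -/
def anchorDeriv (h : M → G) (x₀ x : M) : F →L[ℝ] G :=
  LinearMap.toContinuousLinearMap
    ((mvfderiv I h x : TangentSpace I x →ₗ[ℝ] G) ∘ₗ A.anchor x ∘ₗ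
      (fiberVec F V x₀ x : F →ₗ[ℝ] V x))

theorem anchorDeriv_apply (h : M → G) (x₀ x : M) (v : F) :
    A.anchorDeriv h x₀ x v = mvfderiv I h x (A.anchor x (fiberVec F V x₀ x v)) := rfl

theorem contMDiffAt_anchorDeriv {h : M → G} {x₀ x : M} (hx : x ∈ coordDomain F V x₀)
    (hh : ContMDiffAt I 𝓘(ℝ, G) ∞ h x) :
    ContMDiffAt I 𝓘(ℝ, F →L[ℝ] G) ∞ (A.anchorDeriv h x₀) x :=
  contMDiffAt_clm_of_apply fun v =>
    hh.mvfderiv_apply (A.contMDiffAt_anchor (t := fun y => y) (contMDiffAt_fiberVec hx v))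

/-- The equality `ρ[e_v, e_w] = [ρ e_v, ρ e_w]` for frame sections, tested on `h` by the commutator
identity. -/
theorem anchorDeriv_structMap [I.Boundaryless] {h : M → G} {x₀ x : M}
    (hx : x ∈ flatDomain I F V x₀)
    (hh : ContMDiffAt I 𝓘(ℝ, G) ∞ h x) (v w : F) :
    A.anchorDeriv h x₀ x (A.structMap x₀ x v w) =
      mvfderiv I (A.anchorDeriv h x₀) x (A.anchor x (fiberVec F V x₀ x v)) w -
        mvfderiv I (A.anchorDeriv h x₀) x (A.anchor x (fiberVec F V x₀ x w)) v := by
  have : CompleteSpace EM := FiniteDimensional.complete ℝ EM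
  have hx' := flatDomain_subset_coordDomain x₀ hx
  have hd := (A.contMDiffAt_anchorDeriv hx' hh).mdifferentiableAt (by simp)
  have hs : ∀ s : Cₛ^∞⟮I; F, V⟯, ContMDiffAt I I.tangent ∞
      (fun y => (⟨y, A.anchor y (s y)⟩ : TangentBundle I M)) x :=
    fun s => A.contMDiffAt_anchor (t := fun y => y) s.contMDiff.contMDiffAt
  have key : ∀ v (ξ : TangentSpace I x),
      mvfderiv I (fun y => mvfderiv I h y (A.anchor y (constSection I F V x₀ v y))) x ξ =
        mvfderiv I (A.anchorDeriv h x₀) x ξ v := fun v ξ => by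
    rw [Filter.EventuallyEq.mvfderiv_eq (g := fun y => A.anchorDeriv h x₀ y v),
      mvfderiv_clm_apply hd mdifferentiableAt_const, mvfderiv_const]
    · simp
    · filter_upwards [(isOpen_flatDomain I F V x₀).mem_nhds hx] with y hy
      rw [anchorDeriv_apply, constSection_apply hy]
  rw [anchorDeriv_apply, structMap_apply, fiberVec_fiberCoord hx', A.anchor_bracket,
    mvfderiv_mlieBracket hh (hs _) (hs _), key, key, constSection_apply hx, constSection_apply hx]

end LocalFormulas

end LieAlgebroid

/-! ### The bracket of sections of the prolongation -/

namespace LieAlgebroid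

section ProlongationBracket

variable {EM : Type*} [NormedAddCommGroup EM] [NormedSpace ℝ EM] [FiniteDimensional ℝ EM]
  {HM : Type*} [TopologicalSpace HM] {I : ModelWithCorners ℝ EM HM}
  {M : Type*} [TopologicalSpace M] [T2Space M] [ChartedSpace HM M] [IsManifold I ∞ M]
  {F : Type*} [NormedAddCommGroup F] [NormedSpace ℝ F] [FiniteDimensional ℝ F]
  {V : M → Type*} [TopologicalSpace (TotalSpace F V)]
  [∀ x, TopologicalSpace (V x)] [∀ x, AddCommGroup (V x)] [∀ x, Module ℝ (V x)]
  [FiberBundle F V] [VectorBundle ℝ F V] [ContMDiffVectorBundle ∞ F V I]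
  (A : LieAlgebroid I F V)

/-- The behaviour of the structure functions under a change of trivialization. -/
theorem structMap_change {x₀ x₁ x : M} (h₀ : x ∈ flatDomain I F V x₀)
    (h₁ : x ∈ flatDomain I F V x₁) (v w : F) :
    fiberCoord F V x₀ x (fiberVec F V x₁ x (A.structMap x₁ x v w)) =
      mvfderiv I (fun y => (fiberCoord F V x₀ y).comp (fiberVec F V x₁ y)) x
          (A.anchor x (fiberVec F V x₁ x v)) w -
        mvfderiv I (fun y => (fiberCoord F V x₀ y).comp (fiberVec F V x₁ y)) x
          (A.anchor x (fiberVec F V x₁ x w)) v +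
        A.structMap x₀ x (fiberCoord F V x₀ x (fiberVec F V x₁ x v))
          (fiberCoord F V x₀ x (fiberVec F V x₁ x w)) := by
  have h₀' := flatDomain_subset_coordDomain x₀ h₀
  have h₁' := flatDomain_subset_coordDomain x₁ h₁
  have hd := (contMDiffAt_fiberCoord_comp_fiberVec (I := I) h₁' h₀').mdifferentiableAt (by simp)
  have key : ∀ v (ξ : TangentSpace I x),
      mvfderiv I (fun y => fiberCoord F V x₀ y (constSection I F V x₁ v y)) x ξ =
        mvfderiv I (fun y => (fiberCoord F V x₀ y).comp (fiberVec F V x₁ y)) x ξ v :=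
      fun v ξ => by
    rw [Filter.EventuallyEq.mvfderiv_eq
        (g := fun y => (fiberCoord F V x₀ y).comp (fiberVec F V x₁ y) v),
      mvfderiv_clm_apply hd mdifferentiableAt_const, mvfderiv_const]
    · simp
    · filter_upwards [(isOpen_flatDomain I F V x₁).mem_nhds h₁] with y hy
      rw [constSection_apply hy]
      rfl
  -- The bracket of two sections constant at `x₁` is expanded at `x₀`, where their coordinates are
  -- columns of the transition map; hence the derivatives of that map.
  rw [structMap_apply A x₁, fiberVec_fiberCoord h₁', A.fiberCoord_bracket _ _ h₀, key, key,
    constSection_apply h₁, constSection_apply h₁]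

variable {EP : Type*} [NormedAddCommGroup EP] [NormedSpace ℝ EP]
  {HP : Type*} [TopologicalSpace HP] {J : ModelWithCorners ℝ EP HP}
  {P : Type*} [TopologicalSpace P] [ChartedSpace HP P]
  {A} {τ : P → M}

/-- The coordinates of the first component of a section of the prolongation. -/
def fstCoord (s : ∀ p, A.Prolongation J τ p) (x₀ : M) (q : P) : F :=
  fiberCoord F V x₀ (τ q) (s q).1.1

/-- The bracket of two sections of the prolongation, in a local trivialization. -/
def localBracket (s₁ s₂ : ∀ p, A.Prolongation J τ p) (x₀ : M) (p : P) : F :=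
  mvfderiv J (fstCoord s₂ x₀) p (s₁ p).1.2 - mvfderiv J (fstCoord s₁ x₀) p (s₂ p).1.2 +
    A.structMap x₀ (τ p) (fstCoord s₁ x₀ p) (fstCoord s₂ x₀ p)

/-- The first component of the bracket of two sections of the prolongation. -/
def bracketFst (s₁ s₂ : ∀ p, A.Prolongation J τ p) (p : P) : V (τ p) :=
  fiberVec F V (τ p) (τ p) (localBracket s₁ s₂ (τ p) p)

theorem bracketFst_swap (s₁ s₂ : ∀ p, A.Prolongation J τ p) (p : P) :
    bracketFst s₁ s₂ p = -bracketFst s₂ s₁ p := by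
  rw [bracketFst, bracketFst, ← map_neg, localBracket, localBracket, A.structMap_swap]
  congr 1
  abel

variable [IsManifold J ∞ P]

variable (F) in
/-- A section of the prolongation both components of which are smooth. -/
structure IsSmoothLift (s : ∀ p, A.Prolongation J τ p) : Prop where
  fst : ∀ p, ContMDiffAt J (I.prod 𝓘(ℝ, F)) ∞ (fun q => TotalSpace.mk' F (τ q) (s q).1.1) p
  snd : ∀ p, ContMDiffAt J J.tangent ∞ (fun q => (⟨q, (s q).1.2⟩ : TangentBundle J P)) p

variable {s s₁ s₂ s₃ : ∀ p, A.Prolongation J τ p}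

theorem IsSmoothLift.contMDiffAt_fstCoord (h : IsSmoothLift F s) {x₀ : M} {p : P}
    (hp : τ p ∈ coordDomain F V x₀) : ContMDiffAt J 𝓘(ℝ, F) ∞ (fstCoord s x₀) p :=
  ((contMDiffAt_iff_fiberCoord hp).1 (h.fst p)).2

theorem IsSmoothLift.mdifferentiableAt_fstCoord (h : IsSmoothLift F s) {x₀ : M} {p : P}
    (hp : τ p ∈ coordDomain F V x₀) : MDifferentiableAt J 𝓘(ℝ, F) (fstCoord s x₀) p :=
  (h.contMDiffAt_fstCoord hp).mdifferentiableAt (by simp)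

/-- The chain rule combined with the defining equation `T τ(v) = ρ(b)`. -/
theorem mvfderiv_comp_proj (hτ : ContMDiff J I ∞ τ) {G : Type*} [NormedAddCommGroup G] [NormedSpace ℝ G] {g : M → G}
    {p : P} (hg : MDifferentiableAt I 𝓘(ℝ, G) g (τ p)) (s : ∀ p, A.Prolongation J τ p) :
    mvfderiv J (fun q => g (τ q)) p (s p).1.2 =
      mvfderiv I g (τ p) (A.anchor (τ p) (s p).1.1) := by
  rw [mvfderiv_comp_apply_of_mdifferentiableAt hg (hτ.mdifferentiableAt (by simp))]
  exact congrArg (mvfderiv I g (τ p)) (s p).2.symm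

/-- The product rule in the form needed below, where `g` is a transition map, the derivative of a
chart along the anchor, or the structure map. -/
theorem mvfderiv_proj_clm_apply (hτ : ContMDiff J I ∞ τ)
    {G : Type*} [NormedAddCommGroup G] [NormedSpace ℝ G]
    {g : M → F →L[ℝ] G} {x₀ : M} {p : P} (hg : MDifferentiableAt I 𝓘(ℝ, F →L[ℝ] G) g (τ p))
    (hs : IsSmoothLift F s) (hp : τ p ∈ coordDomain F V x₀) (t : ∀ p, A.Prolongation J τ p) :
    mvfderiv J (fun q => g (τ q) (fstCoord s x₀ q)) p (t p).1.2 =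
      mvfderiv I g (τ p) (A.anchor (τ p) (fiberVec F V x₀ (τ p) (fstCoord t x₀ p)))
          (fstCoord s x₀ p) +
        g (τ p) (mvfderiv J (fstCoord s x₀) p (t p).1.2) := by
  have hgτ : MDifferentiableAt J 𝓘(ℝ, F →L[ℝ] G) (fun q => g (τ q)) p :=
    hg.comp p (hτ.mdifferentiableAt (by simp))
  rw [mvfderiv_clm_apply hgτ (hs.mdifferentiableAt_fstCoord hp),
    mvfderiv_comp_proj hτ hg t,
    show fiberVec F V x₀ (τ p) (fstCoord t x₀ p) = (t p).1.1 from fiberVec_fiberCoord hp _]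

/-- The local formula for the bracket is independent of the trivialization. -/
theorem fiberCoord_bracketFst (hτ : ContMDiff J I ∞ τ)
    (h₁ : IsSmoothLift F s₁) (h₂ : IsSmoothLift F s₂) {x₀ : M} {p : P}
    (hp : τ p ∈ flatDomain I F V x₀) :
    fiberCoord F V x₀ (τ p) (bracketFst s₁ s₂ p) = localBracket s₁ s₂ x₀ p := by
  have hp₁ := mem_flatDomain_self I F V (τ p)
  have hp' := flatDomain_subset_coordDomain x₀ hp
  have hp₁' := flatDomain_subset_coordDomain (τ p) hp₁
  have hg := (contMDiffAt_fiberCoord_comp_fiberVec (I := I) hp₁' hp').mdifferentiableAt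
    (by simp)
  have hco : ∀ {s : ∀ p, A.Prolongation J τ p}, fstCoord s x₀ =ᶠ[𝓝 p]
      fun q => (fiberCoord F V x₀ (τ q)).comp (fiberVec F V (τ p) (τ q)) (fstCoord s (τ p) q) := by
    intro s
    filter_upwards [hτ.continuous.continuousAt.preimage_mem_nhds
      ((isOpen_coordDomain F V (τ p)).mem_nhds hp₁')] with q hq
    exact congrArg (fiberCoord F V x₀ (τ q)) (fiberVec_fiberCoord hq (s q).1.1).symm
  have hder : ∀ {s t : ∀ p, A.Prolongation J τ p}, IsSmoothLift F s →
      mvfderiv J (fstCoord s x₀) p (t p).1.2 =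
        mvfderiv I (fun y => (fiberCoord F V x₀ y).comp (fiberVec F V (τ p) y)) (τ p)
            (A.anchor (τ p) (fiberVec F V (τ p) (τ p) (fstCoord t (τ p) p)))
            (fstCoord s (τ p) p) +
          fiberCoord F V x₀ (τ p) (fiberVec F V (τ p) (τ p)
            (mvfderiv J (fstCoord s (τ p)) p (t p).1.2)) := fun {s t} hs => by
    rw [hco.mvfderiv_eq]
    exact mvfderiv_proj_clm_apply hτ hg hs hp₁' t
  -- The inhomogeneous terms of `structMap_change` are exactly those which the product rule `hder`
  -- produces on the other side.
  rw [bracketFst, localBracket, map_add, map_sub, map_add, map_sub, A.structMap_change hp hp₁,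
    localBracket, hder h₁, hder h₂, (hco (s := s₁)).self_of_nhds, (hco (s := s₂)).self_of_nhds]
  simp only [ContinuousLinearMap.comp_apply]
  abel

theorem contMDiffAt_localBracket (hτ : ContMDiff J I ∞ τ)
    (h₁ : IsSmoothLift F s₁) (h₂ : IsSmoothLift F s₂) {x₀ : M} {p : P}
    (hp : τ p ∈ coordDomain F V x₀) : ContMDiffAt J 𝓘(ℝ, F) ∞ (localBracket s₁ s₂ x₀) p := by
  refine (((h₂.contMDiffAt_fstCoord hp).mvfderiv_apply (h₁.snd p)).sub
    ((h₁.contMDiffAt_fstCoord hp).mvfderiv_apply (h₂.snd p))).add ?_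
  exact (((A.contMDiffAt_structMap hp).comp p hτ.contMDiffAt).clm_apply
    (h₁.contMDiffAt_fstCoord hp)).clm_apply (h₂.contMDiffAt_fstCoord hp)

/-- `bracketFst` uses at each point the trivialization centred there, so smoothness is not visible
from its definition; independence of the trivialization allows one to be fixed near `p`. -/
theorem contMDiffAt_bracketFst (hτ : ContMDiff J I ∞ τ)
    (h₁ : IsSmoothLift F s₁) (h₂ : IsSmoothLift F s₂) (p : P) :
    ContMDiffAt J (I.prod 𝓘(ℝ, F)) ∞
      (fun q => TotalSpace.mk' F (τ q) (bracketFst s₁ s₂ q)) p := by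
  refine (contMDiffAt_iff_fiberCoord (mem_coordDomain_self F V (τ p))).2 ⟨hτ.contMDiffAt, ?_⟩
  refine (contMDiffAt_localBracket hτ h₁ h₂
    (mem_coordDomain_self F V (τ p))).congr_of_eventuallyEq ?_
  filter_upwards [hτ.continuous.continuousAt.preimage_mem_nhds
    ((isOpen_flatDomain I F V (τ p)).mem_nhds (mem_flatDomain_self I F V (τ p)))] with q hq
  exact fiberCoord_bracketFst hτ h₁ h₂ hq

open VectorField in
-- Both sides are tested on a chart `h` at `τ p`, whose derivative is injective. The right side
-- becomes a commutator of derivatives of `h ∘ τ`; each first derivative is `anchorDeriv` applied to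
-- coordinates, and the product rule with `anchorDeriv_structMap` gives the left side.
theorem anchor_bracketFst [I.Boundaryless] [J.Boundaryless] [CompleteSpace EP]
    (hτ : ContMDiff J I ∞ τ)
    (h₁ : IsSmoothLift F s₁) (h₂ : IsSmoothLift F s₂) (p : P) :
    A.anchor (τ p) (bracketFst s₁ s₂ p) =
      mfderiv J I τ p (mlieBracket J (fun q => (s₁ q).1.2) (fun q => (s₂ q).1.2) p) := by
  let h : M → EM := fun x => extChartAt I (τ p) x
  have hτd : ∀ q, MDifferentiableAt J I τ q := fun q => hτ.mdifferentiableAt (by simp)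
  have hh : ∀ x ∈ (chartAt HM (τ p)).source, ContMDiffAt I 𝓘(ℝ, EM) ∞ h x := fun x hx =>
    contMDiffAt_extChartAt' hx
  have hx := mem_chart_source HM (τ p)
  have hinj : Function.Injective (mvfderiv I h (τ p)) := by
    obtain ⟨L, hL⟩ := isInvertible_mfderiv_extChartAt (I := I) (mem_extChartAt_source (I := I) (τ p))
    have : (mvfderiv I h (τ p) : TangentSpace I (τ p) → EM) = L :=
      congrArg (fun L : EM →L[ℝ] EM => (L : EM → EM)) hL.symm
    rw [this]
    exact L.injective
  have hp := mem_flatDomain_self I F V (τ p)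
  have hp' := mem_coordDomain_self F V (τ p)
  have ha := (A.contMDiffAt_anchorDeriv hp' (hh _ hx)).mdifferentiableAt (by simp)
  have hdir : ∀ s : ∀ p, A.Prolongation J τ p,
      (fun q => mvfderiv J (fun q => h (τ q)) q (s q).1.2) =ᶠ[𝓝 p]
        fun q => A.anchorDeriv h (τ p) (τ q) (fstCoord s (τ p) q) := fun s => by
    filter_upwards [hτ.continuous.continuousAt.preimage_mem_nhds
      ((isOpen_coordDomain F V (τ p)).mem_nhds hp'),
      hτ.continuous.continuousAt.preimage_mem_nhds
        ((chartAt HM (τ p)).open_source.mem_nhds hx)] with q hq hq'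
    rw [mvfderiv_comp_proj hτ ((hh _ hq').mdifferentiableAt (by simp)), anchorDeriv_apply,
      fstCoord, fiberVec_fiberCoord hq]
  have hder : ∀ {s t : ∀ p, A.Prolongation J τ p}, IsSmoothLift F s →
      mvfderiv J (fun q => mvfderiv J (fun q => h (τ q)) q (s q).1.2) p (t p).1.2 =
        mvfderiv I (A.anchorDeriv h (τ p)) (τ p)
            (A.anchor (τ p) (fiberVec F V (τ p) (τ p) (fstCoord t (τ p) p)))
            (fstCoord s (τ p) p) +
          A.anchorDeriv h (τ p) (τ p) (mvfderiv J (fstCoord s (τ p)) p (t p).1.2) :=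
      fun {s t} hs => by
    rw [(hdir s).mvfderiv_eq]
    exact mvfderiv_proj_clm_apply hτ ha hs hp' t
  apply hinj
  rw [← mvfderiv_comp_apply_of_mdifferentiableAt ((hh _ hx).mdifferentiableAt (by simp)) (hτd p),
    mvfderiv_mlieBracket (f := fun q => h (τ q)) ((hh _ hx).comp p hτ.contMDiffAt) (h₁.snd p) (h₂.snd p), hder h₁, hder h₂,
    bracketFst, ← anchorDeriv_apply, localBracket, map_add, map_sub,
    A.anchorDeriv_structMap hp (hh _ hx)]
  abel

open VectorField in
/-- The bracket of two smooth sections of the prolongation. -/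
def prolongBracket [I.Boundaryless] [J.Boundaryless] [CompleteSpace EP]
    (hτ : ContMDiff J I ∞ τ) (h₁ : IsSmoothLift F s₁) (h₂ : IsSmoothLift F s₂) (p : P) :
    A.Prolongation J τ p :=
  ⟨(bracketFst s₁ s₂ p, mlieBracket J (fun q => (s₁ q).1.2) (fun q => (s₂ q).1.2) p),
    anchor_bracketFst hτ h₁ h₂ p⟩

theorem isSmoothLift_prolongBracket [I.Boundaryless] [J.Boundaryless] [CompleteSpace EP]
    (hτ : ContMDiff J I ∞ τ) (h₁ : IsSmoothLift F s₁) (h₂ : IsSmoothLift F s₂) :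
    IsSmoothLift F (prolongBracket hτ h₁ h₂) where
  fst p := contMDiffAt_bracketFst hτ h₁ h₂ p
  snd p := by
    have : IsManifold J ((⊤ : ℕ∞) + 1) P := by simpa using ‹IsManifold J ∞ P›
    have h2 : IsManifold J 2 P := .of_le (n := ∞) ENat.LEInfty.out
    have h3 : IsManifold J 3 P := .of_le (n := ∞) ENat.LEInfty.out
    have : IsManifold J (minSmoothness ℝ 2) P := by simpa using h2
    have : IsManifold J (minSmoothness ℝ 3) P := by simpa using h3
    exact ContMDiffAt.mlieBracket_vectorField (n := ⊤) (m := ⊤) (h₁.snd p) (h₂.snd p) (by simp)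

theorem bracketFst_add_right (h₂ : IsSmoothLift F s₂) (h₃ : IsSmoothLift F s₃) (p : P) :
    bracketFst s₁ (s₂ + s₃) p = bracketFst s₁ s₂ p + bracketFst s₁ s₃ p := by
  have hp := mem_coordDomain_self F V (τ p)
  have hadd : fstCoord (s₂ + s₃) (τ p) = fstCoord s₂ (τ p) + fstCoord s₃ (τ p) := by
    funext q
    exact map_add _ _ _
  have hsnd : ((s₂ + s₃) p).1.2 = (s₂ p).1.2 + (s₃ p).1.2 := rfl
  rw [bracketFst, bracketFst, bracketFst, ← map_add, localBracket, localBracket, localBracket,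
    hadd, hsnd, mvfderiv_add (h₂.mdifferentiableAt_fstCoord hp) (h₃.mdifferentiableAt_fstCoord hp),
    Pi.add_apply]
  simp only [map_add, map_sub, add_apply]
  abel

theorem bracketFst_smul_right (f : C^∞⟮J, P; 𝓘(ℝ, ℝ), ℝ⟯) (h₂ : IsSmoothLift F s₂) (p : P) :
    bracketFst s₁ (fun q => f q • s₂ q) p =
      mvfderiv J f p (s₁ p).1.2 • (s₂ p).1.1 + f p • bracketFst s₁ s₂ p := by
  have hp := mem_coordDomain_self F V (τ p)
  have hsmul : fstCoord (fun q => f q • s₂ q) (τ p) = (f : P → ℝ) • fstCoord s₂ (τ p) := by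
    funext q
    exact map_smul _ _ _
  have hsnd : (f p • s₂ p).1.2 = f p • (s₂ p).1.2 := rfl
  rw [bracketFst, bracketFst, localBracket, localBracket,
    hsmul, hsnd, mvfderiv_smul (f.contMDiff.mdifferentiableAt (by simp))
      (h₂.mdifferentiableAt_fstCoord hp), Pi.smul_apply', map_smul, map_smul]
  simp only [add_apply, smul_apply,
    ContinuousLinearMap.smulRight_apply, map_add, map_sub, map_smul, smul_add, smul_sub]
  rw [fstCoord, fiberVec_fiberCoord hp]
  abel

open VectorField in
-- In the cyclic sum the second derivatives cancel by the commutator identity, the terms with one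
-- derivative of a coordinate inside `structMap` cancel by antisymmetry, and the rest is
-- `structMap_jacobi`.
theorem bracketFst_jacobi [I.Boundaryless] [J.Boundaryless] [CompleteSpace EP]
    (hτ : ContMDiff J I ∞ τ) (h₁ : IsSmoothLift F s₁) (h₂ : IsSmoothLift F s₂)
    (h₃ : IsSmoothLift F s₃) (p : P) :
    bracketFst s₁ (prolongBracket hτ h₂ h₃) p + bracketFst s₂ (prolongBracket hτ h₃ h₁) p +
      bracketFst s₃ (prolongBracket hτ h₁ h₂) p = 0 := by
  have hp := mem_flatDomain_self I F V (τ p)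
  have hp' := mem_coordDomain_self F V (τ p)
  have hC := (A.contMDiffAt_structMap hp').mdifferentiableAt (by simp)
  have key : ∀ {s₁ s₂ s₃ : ∀ p, A.Prolongation J τ p} (h₁ : IsSmoothLift F s₁)
      (h₂ : IsSmoothLift F s₂) (h₃ : IsSmoothLift F s₃),
      localBracket s₁ (prolongBracket hτ h₂ h₃) (τ p) p =
        mvfderiv J (fun q => mvfderiv J (fstCoord s₃ (τ p)) q (s₂ q).1.2) p (s₁ p).1.2 -
          mvfderiv J (fun q => mvfderiv J (fstCoord s₂ (τ p)) q (s₃ q).1.2) p (s₁ p).1.2 -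
          (mvfderiv J (fun q => mvfderiv J (fstCoord s₁ (τ p)) q (s₃ q).1.2) p (s₂ p).1.2 -
            mvfderiv J (fun q => mvfderiv J (fstCoord s₁ (τ p)) q (s₂ q).1.2) p (s₃ p).1.2) +
          mvfderiv I (A.structMap (τ p)) (τ p)
            (A.anchor (τ p) (fiberVec F V (τ p) (τ p) (fstCoord s₁ (τ p) p)))
            (fstCoord s₂ (τ p) p) (fstCoord s₃ (τ p) p) +
          A.structMap (τ p) (τ p) (mvfderiv J (fstCoord s₂ (τ p)) p (s₁ p).1.2)
            (fstCoord s₃ (τ p) p) +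
          A.structMap (τ p) (τ p) (fstCoord s₂ (τ p) p)
            (mvfderiv J (fstCoord s₃ (τ p)) p (s₁ p).1.2) +
          A.structMap (τ p) (τ p) (fstCoord s₁ (τ p) p)
            (mvfderiv J (fstCoord s₃ (τ p)) p (s₂ p).1.2) -
          A.structMap (τ p) (τ p) (fstCoord s₁ (τ p) p)
            (mvfderiv J (fstCoord s₂ (τ p)) p (s₃ p).1.2) +
          A.structMap (τ p) (τ p) (fstCoord s₁ (τ p) p)
            (A.structMap (τ p) (τ p) (fstCoord s₂ (τ p) p) (fstCoord s₃ (τ p) p)) := by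
    intro s₁ s₂ s₃ h₁ h₂ h₃
    -- The inner bracket has to be differentiated, so its local formula is needed in one fixed
    -- trivialization on a neighbourhood of `p`.
    have hev : fstCoord (prolongBracket hτ h₂ h₃) (τ p) =ᶠ[𝓝 p] localBracket s₂ s₃ (τ p) := by
      filter_upwards [hτ.continuous.continuousAt.preimage_mem_nhds
        ((isOpen_flatDomain I F V (τ p)).mem_nhds hp)] with q hq
      exact fiberCoord_bracketFst hτ h₂ h₃ hq
    have hd : ∀ {s t : ∀ p, A.Prolongation J τ p}, IsSmoothLift F s → IsSmoothLift F t →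
        MDifferentiableAt J 𝓘(ℝ, F)
          (fun q => mvfderiv J (fstCoord s (τ p)) q (t q).1.2) p := fun hs ht =>
      ((hs.contMDiffAt_fstCoord hp').mvfderiv_apply (ht.snd p)).mdifferentiableAt (by simp)
    have hCs : MDifferentiableAt J 𝓘(ℝ, F →L[ℝ] F)
        (fun q => A.structMap (τ p) (τ q) (fstCoord s₂ (τ p) q)) p :=
      ((((A.contMDiffAt_structMap hp').comp p hτ.contMDiffAt).clm_apply
        (h₂.contMDiffAt_fstCoord hp'))).mdifferentiableAt (by simp)
    have hCss : MDifferentiableAt J 𝓘(ℝ, F)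
        (fun q => A.structMap (τ p) (τ q) (fstCoord s₂ (τ p) q) (fstCoord s₃ (τ p) q)) p :=
      hCs.clm_apply (h₃.mdifferentiableAt_fstCoord hp')
    have hval := hev.self_of_nhds
    have hlb : localBracket s₂ s₃ (τ p) =
        ((fun q => mvfderiv J (fstCoord s₃ (τ p)) q (s₂ q).1.2) -
          fun q => mvfderiv J (fstCoord s₂ (τ p)) q (s₃ q).1.2) +
          fun q => A.structMap (τ p) (τ q) (fstCoord s₂ (τ p) q) (fstCoord s₃ (τ p) q) := rfl
    have hsnd : (prolongBracket hτ h₂ h₃ p).1.2 =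
      mlieBracket J (fun q => (s₂ q).1.2) (fun q => (s₃ q).1.2) p := rfl
    rw [localBracket, hev.mvfderiv_eq, hval, hsnd,
      mvfderiv_mlieBracket (h₁.contMDiffAt_fstCoord hp') (h₂.snd p) (h₃.snd p), hlb,
      mvfderiv_add ((hd h₃ h₂).sub (hd h₂ h₃)) hCss, mvfderiv_sub (hd h₃ h₂) (hd h₂ h₃),
      add_apply, sub_apply,
      mvfderiv_clm_apply hCs (h₃.mdifferentiableAt_fstCoord hp'),
      mvfderiv_proj_clm_apply hτ hC h₂ hp' s₁]
    simp only [Pi.add_apply, Pi.sub_apply, map_add, map_sub, add_apply]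
    abel
  have hJ := A.structMap_jacobi hp (fstCoord s₁ (τ p) p) (fstCoord s₂ (τ p) p)
    (fstCoord s₃ (τ p) p)
  rw [bracketFst, bracketFst, bracketFst, ← map_add, ← map_add, key h₁ h₂ h₃,
    key h₂ h₃ h₁, key h₃ h₁ h₂]
  convert map_zero (fiberVec F V (τ p) (τ p)) using 2
  rw [← hJ, A.structMap_swap _ _ (mvfderiv J (fstCoord s₂ (τ p)) p (s₁ p).1.2),
    A.structMap_swap _ _ (mvfderiv J (fstCoord s₃ (τ p)) p (s₂ p).1.2),
    A.structMap_swap _ _ (mvfderiv J (fstCoord s₁ (τ p)) p (s₃ p).1.2)]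
  abel

/-- For first components pulled back from `M`, derivatives along the vector fields become
derivatives along the anchor, and the local formula becomes that of `A`. -/
theorem bracketFst_of_eventuallyEq (hτ : ContMDiff J I ∞ τ) {σ₁ σ₂ : Cₛ^∞⟮I; F, V⟯} {p : P}
    (h₁ : ∀ᶠ q in 𝓝 p, (s₁ q).1.1 = σ₁ (τ q)) (h₂ : ∀ᶠ q in 𝓝 p, (s₂ q).1.1 = σ₂ (τ q)) :
    bracketFst s₁ s₂ p = A.bracket σ₁ σ₂ (τ p) := by
  have hp := mem_flatDomain_self I F V (τ p)
  have hp' := mem_coordDomain_self F V (τ p)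
  have key : ∀ {s : ∀ p, A.Prolongation J τ p} {σ : Cₛ^∞⟮I; F, V⟯},
      (∀ᶠ q in 𝓝 p, (s q).1.1 = σ (τ q)) → ∀ t : ∀ p, A.Prolongation J τ p,
      mvfderiv J (fstCoord s (τ p)) p (t p).1.2 =
        mvfderiv I (fun y => fiberCoord F V (τ p) y (σ y)) (τ p)
          (A.anchor (τ p) (t p).1.1) := fun {s σ} hs t => by
    have he : fstCoord s (τ p) =ᶠ[𝓝 p] fun q => fiberCoord F V (τ p) (τ q) (σ (τ q)) :=
      hs.mono fun q hq => congrArg (fiberCoord F V (τ p) (τ q)) hq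
    rw [he.mvfderiv_eq]
    exact mvfderiv_comp_proj hτ
      ((contMDiffAt_fiberCoord_section σ hp').mdifferentiableAt (by simp)) t
  apply fiberCoord_injective hp'
  rw [A.fiberCoord_bracket _ _ hp, bracketFst, fiberCoord_fiberVec hp', localBracket, key h₁,
    key h₂, fstCoord, fstCoord, h₁.self_of_nhds, h₂.self_of_nhds]

end ProlongationBracket

end LieAlgebroid

/-! ### The prolongation as a smooth vector bundle -/

namespace LieAlgebroid

/-- Pair `C` with the projection onto its kernel along a complement; by rank-nullity the kernel is
isomorphic to `K`. -/
theorem exists_equiv_prod_of_surjective {EM G : Type*} [NormedAddCommGroup EM] [NormedSpace ℝ EM]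
    [FiniteDimensional ℝ EM] [NormedAddCommGroup G] [NormedSpace ℝ G] [FiniteDimensional ℝ G]
    {K : Type*} [NormedAddCommGroup K] [NormedSpace ℝ K] [FiniteDimensional ℝ K]
    {C : G →L[ℝ] EM} (hC : Function.Surjective C)
    (hK : Module.finrank ℝ EM + Module.finrank ℝ K = Module.finrank ℝ G) :
    ∃ e : G ≃L[ℝ] EM × K, ∀ g, (e g).1 = C g := by
  have hrank := C.toLinearMap.finrank_range_add_finrank_ker
  rw [LinearMap.range_eq_top.2 hC, finrank_top] at hrank
  let κ : C.toLinearMap.ker ≃ₗ[ℝ] K := LinearEquiv.ofFinrankEq _ _ (by omega)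
  obtain ⟨W, hW⟩ := Submodule.exists_isCompl C.toLinearMap.ker
  let g : G →ₗ[ℝ] C.toLinearMap.ker := Submodule.projectionOnto _ W hW
  let e := (C.toLinearMap.equivProdOfSurjectiveOfIsCompl g (LinearMap.range_eq_top.2 hC)
    (Submodule.range_projectionOnto hW)
    (by rwa [show g.ker = W from Submodule.ker_projectionOnto hW])).trans
      ((LinearEquiv.refl ℝ EM).prodCongr κ)
  exact ⟨e.toContinuousLinearEquiv, fun g => rfl⟩

section ProlongationBundle

variable {EM : Type*} [NormedAddCommGroup EM] [NormedSpace ℝ EM] [FiniteDimensional ℝ EM]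
  {HM : Type*} [TopologicalSpace HM] {I : ModelWithCorners ℝ EM HM}
  {M : Type*} [TopologicalSpace M] [ChartedSpace HM M] [IsManifold I ∞ M]
  {F : Type*} [NormedAddCommGroup F] [NormedSpace ℝ F] [FiniteDimensional ℝ F]
  {V : M → Type*} [TopologicalSpace (TotalSpace F V)]
  [∀ x, TopologicalSpace (V x)] [∀ x, AddCommGroup (V x)] [∀ x, Module ℝ (V x)]
  [FiberBundle F V] [VectorBundle ℝ F V] [ContMDiffVectorBundle ∞ F V I]
  {EP : Type*} [NormedAddCommGroup EP] [NormedSpace ℝ EP] [FiniteDimensional ℝ EP]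
  {HP : Type*} [TopologicalSpace HP] {J : ModelWithCorners ℝ EP HP}
  {P : Type*} [TopologicalSpace P] [ChartedSpace HP P] [IsManifold J ∞ P]
  (A : LieAlgebroid I F V) {τ : P → M}

variable (I F V J τ) in
/-- The set of points at which the trivializations of `V`, `TP` and `TM` used for the prolongation
near `p₀` are defined. -/
def prolongDomain (p₀ : P) : Set P :=
  (τ ⁻¹' coordDomain F V (τ p₀) ∩ τ ⁻¹' coordDomain EM (TangentSpace I : M → Type _) (τ p₀)) ∩
    coordDomain EP (TangentSpace J : P → Type _) p₀

theorem isOpen_prolongDomain (hτ : Continuous τ) (p₀ : P) : IsOpen (prolongDomain I F V J τ p₀) :=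
  (((isOpen_coordDomain _ _ _).preimage hτ).inter ((isOpen_coordDomain _ _ _).preimage hτ)).inter
    (isOpen_coordDomain _ _ _)

theorem mem_prolongDomain_self (p₀ : P) : p₀ ∈ prolongDomain I F V J τ p₀ :=
  ⟨⟨mem_coordDomain_self F V (τ p₀), mem_coordDomain_self EM (TangentSpace I : M → Type _) (τ p₀)⟩,
    mem_coordDomain_self _ _ _⟩

variable (J τ) in
/-- The equation `ρ(b) = T_q τ(v)` of the prolongation, in local trivializations near `p₀`. -/
def prolongConstraint (p₀ q : P) : F × EP →L[ℝ] EM :=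
  LinearMap.toContinuousLinearMap (LinearMap.coprod
    ((fiberCoord EM (TangentSpace I : M → Type _) (τ p₀) (τ q)).toLinearMap ∘ₗ
      A.anchor (τ q) ∘ₗ (fiberVec F V (τ p₀) (τ q)).toLinearMap)
    (-((fiberCoord EM (TangentSpace I : M → Type _) (τ p₀) (τ q)).toLinearMap ∘ₗ
      (mfderiv J I τ q).toLinearMap ∘ₗ
        (fiberVec EP (TangentSpace J : P → Type _) p₀ q).toLinearMap)))

theorem prolongConstraint_apply (p₀ q : P) (g : F × EP) :
    A.prolongConstraint J τ p₀ q g =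
      fiberCoord EM (TangentSpace I : M → Type _) (τ p₀) (τ q)
          (A.anchor (τ q) (fiberVec F V (τ p₀) (τ q) g.1)) -
        fiberCoord EM (TangentSpace I : M → Type _) (τ p₀) (τ q)
          (mfderiv J I τ q (fiberVec EP (TangentSpace J : P → Type _) p₀ q g.2)) := by
  rw [sub_eq_add_neg]
  rfl

theorem prolongConstraint_eq_zero_iff {p₀ q : P} (hq : q ∈ prolongDomain I F V J τ p₀)
    (g : F × EP) :
    A.prolongConstraint J τ p₀ q g = 0 ↔
      ((fiberVec F V (τ p₀) (τ q) g.1,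
        fiberVec EP (TangentSpace J : P → Type _) p₀ q g.2) :
          V (τ q) × TangentSpace J q) ∈ A.prolongFiber J τ q := by
  rw [prolongConstraint_apply, sub_eq_zero, (fiberCoord_injective hq.1.2).eq_iff]
  rfl

theorem contMDiffAt_prolongConstraint (hτ : ContMDiff J I ∞ τ) {p₀ q : P}
    (hq : q ∈ prolongDomain I F V J τ p₀) :
    ContMDiffAt J 𝓘(ℝ, F × EP →L[ℝ] EM) ∞ (A.prolongConstraint J τ p₀) q := by
  refine contMDiffAt_clm_of_apply fun g => ?_
  simp only [prolongConstraint_apply]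
  have h₁ := A.contMDiffAt_anchor
    ((contMDiffAt_fiberVec (I := I) hq.1.1 g.1).comp q hτ.contMDiffAt)
  have h₂ := (hτ.contMDiff_tangentMap (m := ∞) (by simp)).contMDiffAt.comp q
    (contMDiffAt_fiberVec (I := J) hq.2 g.2)
  exact ((contMDiffAt_iff_fiberCoord hq.1.2).1 h₁).2.sub ((contMDiffAt_iff_fiberCoord hq.1.2).1 h₂).2

theorem surjective_prolongConstraint_self (hτ : IsFibration I J τ) (p₀ : P) :
    Function.Surjective (A.prolongConstraint J τ p₀ p₀) := by
  intro w
  obtain ⟨v, hv⟩ := hτ.surjective_mfderiv p₀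
    (fiberVec EM (TangentSpace I : M → Type _) (τ p₀) (τ p₀) w)
  -- Submersivity alone suffices, so the `V`-component is `0`; the sign compensates for the minus in
  -- the constraint.
  refine ⟨(0, fiberCoord EP (TangentSpace J : P → Type _) p₀ p₀ (-v)), ?_⟩
  have hv' : mfderiv J I τ p₀ (-v) = -fiberVec EM (TangentSpace I : M → Type _) (τ p₀) (τ p₀) w :=
    ((mfderiv J I τ p₀).map_neg v).trans (congrArg Neg.neg hv)
  rw [prolongConstraint_apply, fiberVec_fiberCoord (mem_coordDomain_self _ _ _), hv',
    (fiberCoord EM (TangentSpace I : M → Type _) (τ p₀) (τ p₀)).map_neg,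
    fiberCoord_fiberVec (mem_coordDomain_self _ _ _), map_zero, map_zero, map_zero, zero_sub,
    neg_neg]

theorem exists_prolongFrame (hτ : IsFibration I J τ) (p₀ : P) :
    ∃ e : (F × EP) ≃L[ℝ] EM × ProlongationModel EM F EP,
      ∀ g, (e g).1 = A.prolongConstraint J τ p₀ p₀ g := by
  -- This makes the truncated subtraction in the rank of `ProlongationModel` a true one.
  have hle : Module.finrank ℝ EM ≤ Module.finrank ℝ EP :=
    LinearMap.finrank_le_finrank_of_surjective (f := (mfderiv J I τ p₀).toLinearMap)
      (hτ.surjective_mfderiv p₀)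
  refine exists_equiv_prod_of_surjective (A.surjective_prolongConstraint_self hτ p₀) ?_
  rw [finrank_euclideanSpace_fin, Module.finrank_prod]
  omega

/-- Linear coordinates on `F × EP` whose first component is the equation of the prolongation
at `p₀`. -/
def prolongFrame (hτ : IsFibration I J τ) (p₀ : P) :
    (F × EP) ≃L[ℝ] EM × ProlongationModel EM F EP :=
  (A.exists_prolongFrame hτ p₀).choose

/-- The coordinates along the prolongation. -/
def frameSnd (hτ : IsFibration I J τ) (p₀ : P) : F × EP →L[ℝ] ProlongationModel EM F EP :=
  (ContinuousLinearMap.snd ℝ _ _).comp (A.prolongFrame hτ p₀).toContinuousLinearMap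

/-- The equation of the prolongation at `q`, together with the coordinates along the prolongation
at `p₀`. -/
def frameMap (hτ : IsFibration I J τ) (p₀ q : P) :
    F × EP →L[ℝ] EM × ProlongationModel EM F EP :=
  (A.prolongConstraint J τ p₀ q).prod (A.frameSnd hτ p₀)

theorem frameMap_self (hτ : IsFibration I J τ) (p₀ : P) :
    A.frameMap hτ p₀ p₀ = (A.prolongFrame hτ p₀).toContinuousLinearMap := by
  refine ContinuousLinearMap.ext fun g => ?_
  exact Prod.ext ((A.exists_prolongFrame hτ p₀).choose_spec g).symm rfl

theorem contMDiffAt_frameMap (hτ : IsFibration I J τ) {p₀ q : P}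
    (hq : q ∈ prolongDomain I F V J τ p₀) :
    ContMDiffAt J 𝓘(ℝ, F × EP →L[ℝ] EM × ProlongationModel EM F EP) ∞ (A.frameMap hτ p₀) q :=
  contMDiffAt_clm_of_apply fun _ =>
    ((A.contMDiffAt_prolongConstraint hτ.contMDiff hq).clm_apply contMDiffAt_const).prodMk_space
      contMDiffAt_const

/-- The domain of the trivialization of the prolongation at `p₀`. -/
def prolongBase (hτ : IsFibration I J τ) (p₀ : P) : Set P :=
  prolongDomain I F V J τ p₀ ∩ A.frameMap hτ p₀ ⁻¹' {L | L.IsInvertible}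

/-- Invertible operators form an open set and `frameMap` is continuous in `q`; coordinates chosen at
`p₀` thus serve nearby. -/
theorem isOpen_prolongBase (hτ : IsFibration I J τ) (p₀ : P) : IsOpen (A.prolongBase hτ p₀) :=
  ContinuousOn.isOpen_inter_preimage
    (fun _ hq => (A.contMDiffAt_frameMap hτ hq).continuousAt.continuousWithinAt)
    (isOpen_prolongDomain hτ.contMDiff.continuous p₀) ContinuousLinearEquiv.isOpen

theorem mem_prolongBase_self (hτ : IsFibration I J τ) (p₀ : P) : p₀ ∈ A.prolongBase hτ p₀ :=
  ⟨mem_prolongDomain_self p₀, A.prolongFrame hτ p₀, (A.frameMap_self hτ p₀).symm⟩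

/-- The local parametrization of the prolongation, in local trivializations of `V` and `TP`. -/
def frameInv (hτ : IsFibration I J τ) (p₀ q : P) : ProlongationModel EM F EP →L[ℝ] F × EP :=
  (A.frameMap hτ p₀ q).inverse.comp (ContinuousLinearMap.inr ℝ _ _)

theorem contMDiffAt_frameInv (hτ : IsFibration I J τ) {p₀ q : P} (hq : q ∈ A.prolongBase hτ p₀) :
    ContMDiffAt J 𝓘(ℝ, ProlongationModel EM F EP →L[ℝ] F × EP) ∞ (A.frameInv hτ p₀) q :=
  (((hq.2 : (A.frameMap hτ p₀ q).IsInvertible).contDiffAt_map_inverse (n := ∞)).contMDiffAt.comp q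
    (A.contMDiffAt_frameMap hτ hq.1)).clm_comp contMDiffAt_const

theorem frameMap_frameInv (hτ : IsFibration I J τ) {p₀ q : P} (hq : q ∈ A.prolongBase hτ p₀)
    (k : ProlongationModel EM F EP) :
    A.frameMap hτ p₀ q (A.frameInv hτ p₀ q k) = (0, k) :=
  (hq.2 : (A.frameMap hτ p₀ q).IsInvertible).self_apply_inverse _

/-- On the kernel of the constraint the first component of `frameMap` vanishes, so `frameSnd` alone
determines the vector. -/
theorem frameInv_frameSnd (hτ : IsFibration I J τ) {p₀ q : P} (hq : q ∈ A.prolongBase hτ p₀)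
    {g : F × EP} (hg : A.prolongConstraint J τ p₀ q g = 0) :
    A.frameInv hτ p₀ q (A.frameSnd hτ p₀ g) = g := by
  have h : ((0 : EM), A.frameSnd hτ p₀ g) = A.frameMap hτ p₀ q g := Prod.ext hg.symm rfl
  exact (congrArg (A.frameMap hτ p₀ q).inverse h).trans
    ((hq.2 : (A.frameMap hτ p₀ q).IsInvertible).inverse_apply_self g)

/-- The coordinates of a vector of the prolongation. -/
def prolongCoord (hτ : IsFibration I J τ) (p₀ q : P) :
    A.Prolongation J τ q →ₗ[ℝ] ProlongationModel EM F EP :=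
  (A.frameSnd hτ p₀).toLinearMap ∘ₗ
    ((fiberCoord F V (τ p₀) (τ q)).toLinearMap.prodMap
      (fiberCoord EP (TangentSpace J : P → Type _) p₀ q).toLinearMap) ∘ₗ
        (A.prolongFiber J τ q).subtype

theorem prolongCoord_apply (hτ : IsFibration I J τ) (p₀ q : P) (z : A.Prolongation J τ q) :
    A.prolongCoord hτ p₀ q z = A.frameSnd hτ p₀ (fiberCoord F V (τ p₀) (τ q) z.1.1,
      fiberCoord EP (TangentSpace J : P → Type _) p₀ q z.1.2) := rfl

open Classical in
/-- The vector of the prolongation with given coordinates. -/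
def prolongVec (hτ : IsFibration I J τ) (p₀ q : P) (k : ProlongationModel EM F EP) :
    A.Prolongation J τ q :=
  if hq : q ∈ A.prolongBase hτ p₀ then
    ⟨(fiberVec F V (τ p₀) (τ q) (A.frameInv hτ p₀ q k).1,
      fiberVec EP (TangentSpace J : P → Type _) p₀ q (A.frameInv hτ p₀ q k).2),
      (A.prolongConstraint_eq_zero_iff hq.1 _).1
        (congrArg Prod.fst (A.frameMap_frameInv hτ hq k))⟩
  else 0

theorem prolongVec_val (hτ : IsFibration I J τ) {p₀ q : P} (hq : q ∈ A.prolongBase hτ p₀)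
    (k : ProlongationModel EM F EP) :
    (A.prolongVec hτ p₀ q k).1 = (fiberVec F V (τ p₀) (τ q) (A.frameInv hτ p₀ q k).1,
      fiberVec EP (TangentSpace J : P → Type _) p₀ q (A.frameInv hτ p₀ q k).2) := by
  rw [prolongVec, dif_pos hq]

theorem prolongCoord_prolongVec (hτ : IsFibration I J τ) {p₀ q : P}
    (hq : q ∈ A.prolongBase hτ p₀) (k : ProlongationModel EM F EP) :
    A.prolongCoord hτ p₀ q (A.prolongVec hτ p₀ q k) = k := by
  rw [prolongCoord_apply, prolongVec_val A hτ hq, fiberCoord_fiberVec hq.1.1.1,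
    fiberCoord_fiberVec hq.1.2]
  exact congrArg Prod.snd (A.frameMap_frameInv hτ hq k)

theorem prolongVec_prolongCoord (hτ : IsFibration I J τ) {p₀ q : P}
    (hq : q ∈ A.prolongBase hτ p₀) (z : A.Prolongation J τ q) :
    A.prolongVec hτ p₀ q (A.prolongCoord hτ p₀ q z) = z := by
  apply Subtype.ext
  rw [prolongVec_val A hτ hq, prolongCoord_apply, frameInv_frameSnd A hτ hq]
  · rw [fiberVec_fiberCoord hq.1.1.1, fiberVec_fiberCoord hq.1.2]
  · rw [prolongConstraint_eq_zero_iff A hq.1, fiberVec_fiberCoord hq.1.1.1,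
      fiberVec_fiberCoord hq.1.2]
    exact z.2

section Smoothness

variable {EN : Type*} [NormedAddCommGroup EN] [NormedSpace ℝ EN]
  {HN : Type*} [TopologicalSpace HN] {JN : ModelWithCorners ℝ EN HN}
  {N : Type*} [TopologicalSpace N] [ChartedSpace HN N] {t : N → P} {n : N}

/-- The base point moves along a map `t : N → P`: a product `N = P × K` gives continuity of the
inverse trivialization, `N = P` the transition maps, and general `N` the smooth maps into the total
space. -/
theorem contMDiffAt_frameInv_apply (hτ : IsFibration I J τ) {p₀ : P}
    {k : N → ProlongationModel EM F EP} (ht : ContMDiffAt JN J ∞ t n)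
    (hk : ContMDiffAt JN 𝓘(ℝ, ProlongationModel EM F EP) ∞ k n)
    (hn : t n ∈ A.prolongBase hτ p₀) :
    ContMDiffAt JN 𝓘(ℝ, F × EP) ∞ (fun m => A.frameInv hτ p₀ (t m) (k m)) n :=
  ((A.contMDiffAt_frameInv hτ hn).comp n ht).clm_apply hk

theorem contMDiffAt_prolongVec_fst (hτ : IsFibration I J τ) {p₀ : P}
    {k : N → ProlongationModel EM F EP} (ht : ContMDiffAt JN J ∞ t n)
    (hk : ContMDiffAt JN 𝓘(ℝ, ProlongationModel EM F EP) ∞ k n)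
    (hn : t n ∈ A.prolongBase hτ p₀) :
    ContMDiffAt JN (I.prod 𝓘(ℝ, F)) ∞
      (fun m => TotalSpace.mk' F (τ (t m)) (A.prolongVec hτ p₀ (t m) (k m)).1.1) n := by
  refine (contMDiffAt_iff_fiberCoord (t := fun m => τ (t m)) hn.1.1.1).2 ⟨hτ.contMDiff.contMDiffAt.comp n ht, ?_⟩
  refine ((ContinuousLinearMap.fst ℝ F EP).contMDiff.contMDiffAt.comp n
    (A.contMDiffAt_frameInv_apply hτ ht hk hn)).congr_of_eventuallyEq ?_
  filter_upwards [ht.continuousAt.preimage_mem_nhds ((A.isOpen_prolongBase hτ p₀).mem_nhds hn)]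
    with m hm
  rw [prolongVec_val A hτ hm, fiberCoord_fiberVec hm.1.1.1]
  rfl

theorem contMDiffAt_prolongVec_snd (hτ : IsFibration I J τ) {p₀ : P}
    {k : N → ProlongationModel EM F EP} (ht : ContMDiffAt JN J ∞ t n)
    (hk : ContMDiffAt JN 𝓘(ℝ, ProlongationModel EM F EP) ∞ k n)
    (hn : t n ∈ A.prolongBase hτ p₀) :
    ContMDiffAt JN J.tangent ∞
      (fun m => (⟨t m, (A.prolongVec hτ p₀ (t m) (k m)).1.2⟩ : TangentBundle J P)) n := by
  refine (contMDiffAt_iff_fiberCoord hn.1.2).2 ⟨ht, ?_⟩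
  refine ((ContinuousLinearMap.snd ℝ F EP).contMDiff.contMDiffAt.comp n
    (A.contMDiffAt_frameInv_apply hτ ht hk hn)).congr_of_eventuallyEq ?_
  filter_upwards [ht.continuousAt.preimage_mem_nhds ((A.isOpen_prolongBase hτ p₀).mem_nhds hn)]
    with m hm
  rw [prolongVec_val A hτ hm, fiberCoord_fiberVec hm.1.2]
  rfl

theorem contMDiffAt_prolongCoord (hτ : IsFibration I J τ) {p₀ : P}
    {s : ∀ m, A.Prolongation J τ (t m)}
    (h₁ : ContMDiffAt JN (I.prod 𝓘(ℝ, F)) ∞ (fun m => TotalSpace.mk' F (τ (t m)) (s m).1.1) n)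
    (h₂ : ContMDiffAt JN J.tangent ∞ (fun m => (⟨t m, (s m).1.2⟩ : TangentBundle J P)) n)
    (hn : t n ∈ A.prolongBase hτ p₀) :
    ContMDiffAt JN 𝓘(ℝ, ProlongationModel EM F EP) ∞
      (fun m => A.prolongCoord hτ p₀ (t m) (s m)) n :=
  have h₁' := ((contMDiffAt_iff_fiberCoord (t := fun m => τ (t m)) hn.1.1.1).1 h₁).2
  have h₂' := ((contMDiffAt_iff_fiberCoord (t := t) hn.1.2).1 h₂).2
  (A.frameSnd hτ p₀).contMDiff.contMDiffAt.comp n (h₁'.prodMk_space h₂')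

end Smoothness

theorem continuous_prolong_proj :
    Continuous (fun z : TotalSpace (ProlongationModel EM F EP) (A.Prolongation J τ) => z.proj) := by
  have hincl : Continuous (A.prolongInclusion J τ (ProlongationModel EM F EP)) :=
    continuous_induced_dom
  exact (FiberBundle.continuous_proj EP (TangentSpace J : P → Type _)).comp hincl.snd

/-- The trivialization of the prolongation at `p₀`. -/
def prolongTriv (hτ : IsFibration I J τ) (p₀ : P) :
    Trivialization (ProlongationModel EM F EP)
      (π (ProlongationModel EM F EP) (A.Prolongation J τ)) where
  toFun z := (z.proj, A.prolongCoord hτ p₀ z.proj z.snd)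
  invFun y := ⟨y.1, A.prolongVec hτ p₀ y.1 y.2⟩
  source := π (ProlongationModel EM F EP) (A.Prolongation J τ) ⁻¹' A.prolongBase hτ p₀
  target := A.prolongBase hτ p₀ ×ˢ Set.univ
  map_source' _ hz := ⟨hz, trivial⟩
  map_target' _ hy := hy.1
  left_inv' z hz := by
    rw [prolongVec_prolongCoord A hτ hz]
  right_inv' y hy := by
    rw [prolongCoord_prolongVec A hτ hy.1]
  open_source := (A.isOpen_prolongBase hτ p₀).preimage A.continuous_prolong_proj
  open_target := (A.isOpen_prolongBase hτ p₀).prod isOpen_univ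
  continuousOn_toFun := by
    intro z hz
    have hincl : Continuous (A.prolongInclusion J τ (ProlongationModel EM F EP)) :=
      continuous_induced_dom
    have h₁ : ContinuousAt (fun z : TotalSpace (ProlongationModel EM F EP) (A.Prolongation J τ) =>
        fiberCoord F V (τ p₀) (τ z.proj) z.snd.1.1) z := by
      refine (((trivializationAt F V (τ p₀)).continuousAt
        (x := (A.prolongInclusion J τ _ z).1) ?_).snd.comp
          (f := fun z => (A.prolongInclusion J τ (ProlongationModel EM F EP) z).1)
          hincl.fst.continuousAt).congr ?_
      · exact (Trivialization.mem_source _).2 hz.1.1.1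
      · filter_upwards [((A.isOpen_prolongBase hτ p₀).preimage
          A.continuous_prolong_proj).mem_nhds hz] with y hy
        exact ((trivializationAt F V (τ p₀)).continuousLinearMapAt_apply_of_mem (R := ℝ)
          hy.1.1.1 _).symm
    have h₂ : ContinuousAt (fun z : TotalSpace (ProlongationModel EM F EP) (A.Prolongation J τ) =>
        fiberCoord EP (TangentSpace J : P → Type _) p₀ z.proj z.snd.1.2) z := by
      refine (((trivializationAt EP (TangentSpace J : P → Type _) p₀).continuousAt
        (x := (A.prolongInclusion J τ _ z).2) ?_).snd.comp
          (f := fun z => (A.prolongInclusion J τ (ProlongationModel EM F EP) z).2)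
          hincl.snd.continuousAt).congr ?_
      · exact (Trivialization.mem_source _).2 hz.1.2
      · filter_upwards [((A.isOpen_prolongBase hτ p₀).preimage
          A.continuous_prolong_proj).mem_nhds hz] with y hy
        exact ((trivializationAt EP (TangentSpace J : P → Type _) p₀).continuousLinearMapAt_apply_of_mem
          (R := ℝ) hy.1.2 _).symm
    exact (A.continuous_prolong_proj.continuousAt.prodMk
      ((A.frameSnd hτ p₀).continuous.continuousAt.comp (h₁.prodMk h₂))).continuousWithinAt
  continuousOn_invFun := by
    intro y hy
    refine ContinuousAt.continuousWithinAt ?_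
    -- As the topology is induced from `V × TP`, continuity is checked on the two components.
    have hinc : Topology.IsInducing (A.prolongInclusion J τ (ProlongationModel EM F EP)) := ⟨rfl⟩
    rw [hinc.continuousAt_iff]
    exact (A.contMDiffAt_prolongVec_fst (JN := J.prod 𝓘(ℝ, ProlongationModel EM F EP)) hτ
      (t := Prod.fst) (k := Prod.snd) contMDiffAt_fst contMDiffAt_snd hy.1).continuousAt.prodMk
      (A.contMDiffAt_prolongVec_snd (JN := J.prod 𝓘(ℝ, ProlongationModel EM F EP)) hτ
      (t := Prod.fst) (k := Prod.snd) contMDiffAt_fst contMDiffAt_snd hy.1).continuousAt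
  baseSet := A.prolongBase hτ p₀
  open_baseSet := A.isOpen_prolongBase hτ p₀
  source_eq := rfl
  target_eq := rfl
  proj_toFun _ _ := rfl

/-- The fibre bundle structure of the prolongation. -/
abbrev prolongFiberBundle (hτ : IsFibration I J τ) :
    FiberBundle (ProlongationModel EM F EP) (A.Prolongation J τ) where
  totalSpaceMk_isInducing' p := by
    have hinc : Topology.IsInducing (A.prolongInclusion J τ (ProlongationModel EM F EP)) := ⟨rfl⟩
    rw [← hinc.of_comp_iff]
    exact ((FiberBundle.totalSpaceMk_isInducing F V (τ p)).prodMap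
      (FiberBundle.totalSpaceMk_isInducing EP (TangentSpace J : P → Type _) p)).comp
        Topology.IsInducing.subtypeVal
  trivializationAtlas' := Set.range (A.prolongTriv hτ)
  trivializationAt' := A.prolongTriv hτ
  mem_baseSet_trivializationAt' := A.mem_prolongBase_self hτ
  trivialization_mem_atlas' := Set.mem_range_self

instance isLinear_prolongTriv (hτ : IsFibration I J τ) (p₀ : P) :
    (A.prolongTriv hτ p₀).IsLinear ℝ :=
  ⟨fun q _ => (A.prolongCoord hτ p₀ q).isLinear⟩

/-- The transition map is `prolongVec` at `p₀` followed by `prolongCoord` at `p₁`, both smooth in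
terms of components. -/
theorem contMDiffOn_coordChangeL_prolongTriv (hτ : IsFibration I J τ) (p₀ p₁ : P) :
    ContMDiffOn J 𝓘(ℝ, ProlongationModel EM F EP →L[ℝ] ProlongationModel EM F EP) ∞
      (fun q => ((A.prolongTriv hτ p₀).coordChangeL ℝ (A.prolongTriv hτ p₁) q :
        ProlongationModel EM F EP →L[ℝ] ProlongationModel EM F EP))
      ((A.prolongTriv hτ p₀).baseSet ∩ (A.prolongTriv hτ p₁).baseSet) := by
  intro q hq
  refine (contMDiffAt_clm_of_apply fun k => ?_).contMDiffWithinAt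
  refine (A.contMDiffAt_prolongCoord (t := fun q => q) hτ
    (A.contMDiffAt_prolongVec_fst (t := fun q => q) hτ contMDiffAt_id
      (contMDiffAt_const (c := k)) hq.1)
    (A.contMDiffAt_prolongVec_snd (t := fun q => q) hτ contMDiffAt_id
      (contMDiffAt_const (c := k)) hq.1) hq.2).congr_of_eventuallyEq ?_
  filter_upwards [((A.prolongTriv hτ p₀).open_baseSet.inter
    (A.prolongTriv hτ p₁).open_baseSet).mem_nhds hq] with y hy
  refine ((A.prolongTriv hτ p₀).coordChangeL_apply' (R := ℝ) (A.prolongTriv hτ p₁) hy k).trans ?_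
  rfl

theorem prolongVectorBundle (hτ : IsFibration I J τ) :
    let _ := A.prolongFiberBundle hτ
    VectorBundle ℝ (ProlongationModel EM F EP) (A.Prolongation J τ) :=
  let _ := A.prolongFiberBundle hτ
  { trivialization_linear' := by
      rintro _ ⟨⟨p₀, rfl⟩⟩
      exact A.isLinear_prolongTriv hτ p₀
    continuousOn_coordChange' := by
      rintro _ _ ⟨⟨p₀, rfl⟩⟩ ⟨⟨p₁, rfl⟩⟩
      exact (A.contMDiffOn_coordChangeL_prolongTriv hτ p₀ p₁).continuousOn }

theorem prolongContMDiffVectorBundle (hτ : IsFibration I J τ) :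
    let _ := A.prolongFiberBundle hτ
    let _ := A.prolongVectorBundle hτ
    ContMDiffVectorBundle ∞ (ProlongationModel EM F EP) (A.Prolongation J τ) J :=
  let _ := A.prolongFiberBundle hτ
  let _ := A.prolongVectorBundle hτ
  { contMDiffOn_coordChangeL := by
      rintro _ _ ⟨⟨p₀, rfl⟩⟩ ⟨⟨p₁, rfl⟩⟩
      exact A.contMDiffOn_coordChangeL_prolongTriv hτ p₀ p₁ }

/-- A map to the prolongation is smooth if and only if its components are. -/
theorem contMDiffAt_prolong_iff {EN : Type*} [NormedAddCommGroup EN] [NormedSpace ℝ EN]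
    {HN : Type*} [TopologicalSpace HN] {JN : ModelWithCorners ℝ EN HN}
    {N : Type*} [TopologicalSpace N] [ChartedSpace HN N] (hτ : IsFibration I J τ)
    {f : N → TotalSpace (ProlongationModel EM F EP) (A.Prolongation J τ)} {n : N} :
    let _ := A.prolongFiberBundle hτ
    ContMDiffAt JN (J.prod 𝓘(ℝ, ProlongationModel EM F EP)) ∞ f n ↔
      ContMDiffAt JN (I.prod 𝓘(ℝ, F)) ∞
          (fun m => TotalSpace.mk' F (τ (f m).proj) (f m).snd.1.1) n ∧
        ContMDiffAt JN J.tangent ∞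
          (fun m => (⟨(f m).proj, (f m).snd.1.2⟩ : TangentBundle J P)) n := by
  let _ := A.prolongFiberBundle hτ
  let _ := A.prolongVectorBundle hτ
  have hn := A.mem_prolongBase_self hτ (f n).proj
  refine (contMDiffAt_totalSpace (f := f)).trans ?_
  constructor
  · rintro ⟨h₁, h₂⟩
    -- Near `n` the map is recovered from its coordinates by `prolongVec`, whose components are
    -- smooth.
    have hev : ∀ᶠ m in 𝓝 n, A.prolongVec hτ (f n).proj (f m).proj
        (A.prolongCoord hτ (f n).proj (f m).proj (f m).snd) = (f m).snd := by
      filter_upwards [h₁.continuousAt.preimage_mem_nhds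
        ((A.isOpen_prolongBase hτ (f n).proj).mem_nhds hn)] with m hm
      exact A.prolongVec_prolongCoord hτ hm _
    refine ⟨(A.contMDiffAt_prolongVec_fst hτ h₁ h₂ hn).congr_of_eventuallyEq ?_,
      (A.contMDiffAt_prolongVec_snd hτ h₁ h₂ hn).congr_of_eventuallyEq ?_⟩
    · filter_upwards [hev] with m hm
      exact congrArg (fun z : A.Prolongation J τ (f m).proj =>
        TotalSpace.mk' F (τ (f m).proj) z.1.1) hm.symm
    · filter_upwards [hev] with m hm
      exact congrArg (fun z : A.Prolongation J τ (f m).proj =>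
        (⟨(f m).proj, z.1.2⟩ : TangentBundle J P)) hm.symm
  · rintro ⟨h₁, h₂⟩
    exact ⟨((contMDiffAt_iff_fiberCoord (mem_coordDomain_self _ _ _)).1 h₂).1,
      A.contMDiffAt_prolongCoord (s := fun m => (f m).snd) hτ h₁ h₂ hn⟩

end ProlongationBundle

end LieAlgebroid

/-! ### The Lie algebroid structure on the prolongation -/

namespace LieAlgebroid

section ProlongationAlgebroid

variable {EM : Type*} [NormedAddCommGroup EM] [NormedSpace ℝ EM] [FiniteDimensional ℝ EM]
  {HM : Type*} [TopologicalSpace HM] {I : ModelWithCorners ℝ EM HM} [I.Boundaryless]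
  {M : Type*} [TopologicalSpace M] [T2Space M] [ChartedSpace HM M] [IsManifold I ∞ M]
  {F : Type*} [NormedAddCommGroup F] [NormedSpace ℝ F] [FiniteDimensional ℝ F]
  {V : M → Type*} [TopologicalSpace (TotalSpace F V)]
  [∀ x, TopologicalSpace (V x)] [∀ x, AddCommGroup (V x)] [∀ x, Module ℝ (V x)]
  [FiberBundle F V] [VectorBundle ℝ F V] [ContMDiffVectorBundle ∞ F V I]
  {EP : Type*} [NormedAddCommGroup EP] [NormedSpace ℝ EP] [FiniteDimensional ℝ EP]
  {HP : Type*} [TopologicalSpace HP] {J : ModelWithCorners ℝ EP HP} [J.Boundaryless]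
  {P : Type*} [TopologicalSpace P] [ChartedSpace HP P] [IsManifold J ∞ P]
  {A : LieAlgebroid I F V} {τ : P → M} {s₁ s₂ s₃ : ∀ p, A.Prolongation J τ p}

open VectorField

theorem IsSmoothLift.mdifferentiableAt_snd {s : ∀ p, A.Prolongation J τ p} (h : IsSmoothLift F s)
    (p : P) : MDifferentiableAt J J.tangent (fun q => (⟨q, (s q).1.2⟩ : TangentBundle J P)) p :=
  (h.snd p).mdifferentiableAt (by simp)

theorem prolongBracket_swap (hτ : ContMDiff J I ∞ τ) (h₁ : IsSmoothLift F s₁)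
    (h₂ : IsSmoothLift F s₂) (p : P) :
    prolongBracket hτ h₁ h₂ p = -prolongBracket hτ h₂ h₁ p :=
  Subtype.ext (Prod.ext (bracketFst_swap s₁ s₂ p) mlieBracket_swap_apply)

theorem prolongBracket_self (hτ : ContMDiff J I ∞ τ) (h₁ : IsSmoothLift F s₁) (p : P) :
    prolongBracket hτ h₁ h₁ p = 0 := by
  have h : (2 : ℝ) • prolongBracket hτ h₁ h₁ p = 0 := by
    rw [two_smul]
    nth_rw 2 [prolongBracket_swap]
    exact add_neg_cancel _
  exact (smul_eq_zero.1 h).resolve_left two_ne_zero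

theorem prolongBracket_add_right (hτ : ContMDiff J I ∞ τ) (h₁ : IsSmoothLift F s₁)
    (h₂ : IsSmoothLift F s₂) (h₃ : IsSmoothLift F s₃) (h : IsSmoothLift F (s₂ + s₃)) (p : P) :
    prolongBracket hτ h₁ h p = prolongBracket hτ h₁ h₂ p + prolongBracket hτ h₁ h₃ p :=
  Subtype.ext (Prod.ext (bracketFst_add_right h₂ h₃ p)
    (mlieBracket_add_right (h₂.mdifferentiableAt_snd p) (h₃.mdifferentiableAt_snd p)))

theorem prolongBracket_smul_right (hτ : ContMDiff J I ∞ τ) (h₁ : IsSmoothLift F s₁)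
    (h₂ : IsSmoothLift F s₂) (f : C^∞⟮J, P; 𝓘(ℝ, ℝ), ℝ⟯)
    (h : IsSmoothLift F (fun q => f q • s₂ q)) (p : P) :
    prolongBracket hτ h₁ h p =
      mvfderiv J f p (s₁ p).1.2 • s₂ p + f p • prolongBracket hτ h₁ h₂ p :=
  Subtype.ext (Prod.ext (bracketFst_smul_right f h₂ p)
    (mlieBracket_smul_right (f.contMDiff.mdifferentiableAt (by simp))
      (h₂.mdifferentiableAt_snd p)))

theorem prolongBracket_jacobi (hτ : ContMDiff J I ∞ τ) (h₁ : IsSmoothLift F s₁)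
    (h₂ : IsSmoothLift F s₂) (h₃ : IsSmoothLift F s₃) (p : P) :
    prolongBracket hτ h₁ (isSmoothLift_prolongBracket hτ h₂ h₃) p +
      prolongBracket hτ h₂ (isSmoothLift_prolongBracket hτ h₃ h₁) p +
        prolongBracket hτ h₃ (isSmoothLift_prolongBracket hτ h₁ h₂) p = 0 := by
  refine Subtype.ext (Prod.ext (bracketFst_jacobi hτ h₁ h₂ h₃ p) ?_)
  have h3 : IsManifold J 3 P := .of_le (n := ∞) ENat.LEInfty.out
  have : IsManifold J (minSmoothness ℝ 3) P := by simpa using h3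
  have hs : ∀ {s : ∀ p, A.Prolongation J τ p}, IsSmoothLift F s →
      ContMDiffAt J J.tangent (minSmoothness ℝ 2)
        (fun q => (⟨q, (s q).1.2⟩ : TangentBundle J P)) p := fun h => by
    simpa using (h.snd p).of_le ENat.LEInfty.out
  -- The second component is the Jacobi identity of vector fields, here in Leibniz form;
  -- antisymmetry turns it into the cyclic sum.
  have h := leibniz_identity_mlieBracket_apply (hs h₁) (hs h₂) (hs h₃)
  change mlieBracket J (fun q => (s₁ q).1.2)
      (mlieBracket J (fun q => (s₂ q).1.2) (fun q => (s₃ q).1.2)) p +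
    mlieBracket J (fun q => (s₂ q).1.2)
      (mlieBracket J (fun q => (s₃ q).1.2) (fun q => (s₁ q).1.2)) p +
    mlieBracket J (fun q => (s₃ q).1.2)
      (mlieBracket J (fun q => (s₁ q).1.2) (fun q => (s₂ q).1.2)) p = 0
  have hneg : mlieBracket J (fun q => (s₂ q).1.2)
      (mlieBracket J (fun q => (s₃ q).1.2) (fun q => (s₁ q).1.2)) p =
        -mlieBracket J (fun q => (s₂ q).1.2)
          (mlieBracket J (fun q => (s₁ q).1.2) (fun q => (s₃ q).1.2)) p := by
    have hm := ((isSmoothLift_prolongBracket hτ h₁ h₃).mdifferentiableAt_snd p)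
    have := mlieBracket_const_smul_right (I := J) (c := (-1 : ℝ))
      (V := fun q => (s₂ q).1.2) hm
    rw [neg_one_smul, neg_one_smul] at this
    rw [mlieBracket_swap (V := fun q => (s₃ q).1.2)]
    exact this
  rw [h, hneg, mlieBracket_swap_apply (V := fun q => (s₃ q).1.2)]
  abel

variable (hτ : IsFibration I J τ)

theorem isSmoothLift_section :
    letI := A.prolongFiberBundle hτ
    letI := A.prolongVectorBundle hτ
    ∀ s : Cₛ^∞⟮J; ProlongationModel EM F EP, A.Prolongation J τ⟯, IsSmoothLift F s := by
  let _ := A.prolongFiberBundle hτ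
  let _ := A.prolongVectorBundle hτ
  exact fun s => ⟨fun p => ((A.contMDiffAt_prolong_iff hτ).1 (s.contMDiff p)).1,
    fun p => ((A.contMDiffAt_prolong_iff hτ).1 (s.contMDiff p)).2⟩

/-- The bracket of two smooth sections of the prolongation, as a smooth section. -/
def bracketSection :
    letI := A.prolongFiberBundle hτ
    letI := A.prolongVectorBundle hτ
    ∀ _ _ : Cₛ^∞⟮J; ProlongationModel EM F EP, A.Prolongation J τ⟯,
      Cₛ^∞⟮J; ProlongationModel EM F EP, A.Prolongation J τ⟯ :=
  letI := A.prolongFiberBundle hτ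
  letI := A.prolongVectorBundle hτ
  fun s₁ s₂ =>
    have h := isSmoothLift_prolongBracket hτ.contMDiff (isSmoothLift_section hτ s₁)
      (isSmoothLift_section hτ s₂)
    ⟨prolongBracket hτ.contMDiff (isSmoothLift_section hτ s₁) (isSmoothLift_section hτ s₂),
      fun p => (A.contMDiffAt_prolong_iff hτ).2 ⟨h.fst p, h.snd p⟩⟩

variable (A) in
/-- The Lie algebroid structure on the prolongation. -/
def prolongation :
    letI := A.prolongFiberBundle hτ
    letI := A.prolongVectorBundle hτ
    LieAlgebroid J (ProlongationModel EM F EP) (A.Prolongation J τ) :=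
  letI := A.prolongFiberBundle hτ
  letI := A.prolongVectorBundle hτ
  have hs := isSmoothLift_section hτ
  have hswap : ∀ s t : Cₛ^∞⟮J; ProlongationModel EM F EP, A.Prolongation J τ⟯,
      bracketSection hτ s t = -bracketSection hτ t s := fun s t =>
    ContMDiffSection.ext fun p => prolongBracket_swap hτ.contMDiff (hs s) (hs t) p
  have hadd : ∀ s t u : Cₛ^∞⟮J; ProlongationModel EM F EP, A.Prolongation J τ⟯,
      bracketSection hτ s (t + u) = bracketSection hτ s t + bracketSection hτ s u := fun s t u =>
    ContMDiffSection.ext fun p =>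
      prolongBracket_add_right hτ.contMDiff (hs s) (hs t) (hs u) (hs (t + u)) p
  have hsmul : ∀ (c : ℝ) (s t : Cₛ^∞⟮J; ProlongationModel EM F EP, A.Prolongation J τ⟯),
      bracketSection hτ s (c • t) = c • bracketSection hτ s t := fun c s t =>
    ContMDiffSection.ext fun p => by
      -- Homogeneity over `ℝ` is the Leibniz rule for a constant function.
      refine (prolongBracket_smul_right hτ.contMDiff (hs s) (hs t) (ContMDiffMap.const c)
        (hs (c • t)) p).trans ?_
      have h0 : mvfderiv J (ContMDiffMap.const c : C^∞⟮J, P; 𝓘(ℝ, ℝ), ℝ⟯) p (s p).1.2 = 0 :=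
        congrArg (fun L : TangentSpace J p →L[ℝ] ℝ => L (s p).1.2) (mvfderiv_const (c := c))
      rw [h0, zero_smul, zero_add]
      rfl
  { bracket := LinearMap.mk₂ ℝ (bracketSection hτ)
      (fun s t u => by rw [hswap, hadd, hswap s, hswap t]; abel)
      (fun c s t => by rw [hswap, hsmul, hswap s, smul_neg])
      hadd (fun c s t => hsmul c s t)
    anchor := fun p => LinearMap.snd ℝ _ _ ∘ₗ (A.prolongFiber J τ p).subtype
    contMDiff_anchor := fun z => ((A.contMDiffAt_prolong_iff hτ).1 contMDiffAt_id).2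
    bracket_self := fun s => ContMDiffSection.ext fun p => prolongBracket_self hτ.contMDiff (hs s) p
    jacobi := fun s t u => ContMDiffSection.ext fun p =>
      prolongBracket_jacobi hτ.contMDiff (hs s) (hs t) (hs u) p
    -- The anchor is the second component, and the second component of the bracket is the Lie
    -- bracket by construction.
    anchor_bracket := fun _ _ _ => rfl
    leibniz := fun f s t p => prolongBracket_smul_right hτ.contMDiff (hs s) (hs t) f
      (hs (smulSection f t)) p }

end ProlongationAlgebroid

end LieAlgebroid

/-! ### The main theorem -/

theorem mainTheorem5
    {EM : Type*} [NormedAddCommGroup EM] [NormedSpace ℝ EM] [FiniteDimensional ℝ EM]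
    {HM : Type*} [TopologicalSpace HM] (I : ModelWithCorners ℝ EM HM) [I.Boundaryless]
    {M : Type*} [TopologicalSpace M] [T2Space M] [ChartedSpace HM M] [IsManifold I ∞ M]
    {F : Type*} [NormedAddCommGroup F] [NormedSpace ℝ F] [FiniteDimensional ℝ F]
    (V : M → Type*) [TopologicalSpace (TotalSpace F V)]
    [∀ x, TopologicalSpace (V x)] [∀ x, AddCommGroup (V x)] [∀ x, Module ℝ (V x)]
    [FiberBundle F V] [VectorBundle ℝ F V] [ContMDiffVectorBundle ∞ F V I]
    {EP : Type*} [NormedAddCommGroup EP] [NormedSpace ℝ EP] [FiniteDimensional ℝ EP]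
    {HP : Type*} [TopologicalSpace HP] (J : ModelWithCorners ℝ EP HP) [J.Boundaryless]
    {P : Type*} [TopologicalSpace P] [T2Space P] [ChartedSpace HP P] [IsManifold J ∞ P]
    (A : LieAlgebroid I F V) (τ : P → M) (hτ : IsFibration I J τ) :
    -- the prolongation is a smooth vector bundle over `P`
    ∃ (_ : FiberBundle (LieAlgebroid.ProlongationModel EM F EP) (A.Prolongation J τ))
      (_ : VectorBundle ℝ (LieAlgebroid.ProlongationModel EM F EP) (A.Prolongation J τ))
      (_ : ContMDiffVectorBundle ∞ (LieAlgebroid.ProlongationModel EM F EP) (A.Prolongation J τ) J),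
      -- whose smooth structure is that of a subbundle of `τ^* V ⊕ TP`
      (∀ (s : ∀ p, A.Prolongation J τ p) (p : P),
        ContMDiffAt J (J.prod 𝓘(ℝ, LieAlgebroid.ProlongationModel EM F EP)) ∞
            (fun q => TotalSpace.mk' (LieAlgebroid.ProlongationModel EM F EP) q (s q)) p ↔
          ContMDiffAt J (I.prod 𝓘(ℝ, F)) ∞ (fun q => TotalSpace.mk' F (τ q) (s q).1.1) p ∧
          ContMDiffAt J J.tangent ∞ (fun q => (⟨q, (s q).1.2⟩ : TangentBundle J P)) p) ∧
      -- and it carries a Lie algebroid structure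
      ∃ B : LieAlgebroid J (LieAlgebroid.ProlongationModel EM F EP) (A.Prolongation J τ),
        -- whose anchor is the projection to `TP`
        (∀ (p : P) (z : A.Prolongation J τ p), B.anchor p z = z.1.2) ∧
        -- and whose bracket on (locally) projectable sections `p ↦ (p, σ (τ p), X p)` is
        -- `[(σ₁, X₁), (σ₂, X₂)] = ([σ₁, σ₂], [X₁, X₂])`
        ∀ (s₁ s₂ : Cₛ^∞⟮J; LieAlgebroid.ProlongationModel EM F EP, A.Prolongation J τ⟯)
          (σ₁ σ₂ : Cₛ^∞⟮I; F, V⟯) (p : P),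
          (∀ᶠ q in 𝓝 p, (s₁ q).1.1 = σ₁ (τ q)) → (∀ᶠ q in 𝓝 p, (s₂ q).1.1 = σ₂ (τ q)) →
            (B.bracket s₁ s₂ p).1 =
              (A.bracket σ₁ σ₂ (τ p),
                VectorField.mlieBracket J (fun q => (s₁ q).1.2) (fun q => (s₂ q).1.2) p) := by

  refine ⟨A.prolongFiberBundle hτ, A.prolongVectorBundle hτ, A.prolongContMDiffVectorBundle hτ,
    fun s p => A.contMDiffAt_prolong_iff hτ, A.prolongation hτ, fun _ _ => rfl, ?_⟩
  intro s₁ s₂ σ₁ σ₂ p h₁ h₂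
  exact Prod.ext (LieAlgebroid.bracketFst_of_eventuallyEq hτ.contMDiff h₁ h₂) rfl

end
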